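/- **Height process.** Let $a>0$. An admissible height function is $\varphi:\mathbb Z^2\to\mathbb Z$ with $4\mid\varphi(0,0)$ such that, for $i+j$ even, $\varphi(i\pm1,j)-\varphi(i,j)\in\{-1,3\}$ and $\varphi(i,j\pm1)-\varphi(i,j)\in\{1,-3\}$; $\Phi$ is the set of these. Let $\omega=(\omega(x,t))_{x\in\mathbb Z^2,t\in\mathbb N}$ be i.i.d. marks, equal to $1$ with probability $\frac1{1+a}$ and to $0$ with probability $\frac a{1+a}$. The local rule at a face of height $h$ is: the new height is $h-4$ if the upper or lower neighbour has height $h-3$; otherwise $h$ if the left or right neighbour has height $h+3$; otherwise $h-4$ if the mark of the face is $1$ and $h$ if it is $0$. A shuffle first applies the rule at all faces $(i,j)$ with $i+j$ even, and then at all faces with $i+j$ odd, where in the second step the (updated) heights of the neighbours are read after adding $2$. Let $h(\cdot,t;\varphi,\omega)$ be the result of $t$ shuffles started from $\varphi$, the shuffle at time $t=1,2,\dots$ using the marks $\omega(\cdot,t)$, and let $\gamma_s\omega(x,t)=\omega(x,t+s)$. **Discrete evolution.** Let $\Gamma$ be the set of $g:\mathbb R^2\to\mathbb R$ with $|g(x)-g(y)|\le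 2|x-y|_\infty$, and let $v(x)=\min\{\varphi(x):\varphi\in\Phi,\ \varphi(0)=0\}$. For $n\ge1$, $g\in\Gamma$ let $\varphi^n_g$ be the pointwise maximum of all $\varphi\in\Phi$ of the form $\varphi=v(\cdot-y)+k$ with $y\in\mathbb Z^2$, $k\in\mathbb Z$, $k\le n\,g(y/n)$. For $\varphi\in\Phi$ let $I\varphi:\mathbb R^2\to\mathbb R$ be the function that agrees with $\varphi$ on $2\mathbb Z^2$, takes at the centre of each square $[2i,2i+2]\times[2j,2j+2]$ the mean of the largest and the smallest value at the four corners, and is affine on each of the four triangles into which the diagonals cut the square. Let $C_0$ be a constant with $|I\varphi(x)-\varphi(x)|<C_0$ for all $\varphi\in\Phi$, $x\in\mathbb Z^2$ (for instance $C_0=4$). For $s,t\in\frac1n\mathbb N$ put $$S_n(s,t;g,\omega)(x)=\tfrac1n\, I\bigl[h(\cdot,n(t-s);\varphi^n_g,\gamma_{ns}\omega)\bigr](nx)\ \text{ if } s<t,\qquad S_n(s,t;g,\omega)=g\ \text{ if } s\ge t,$$ $$\hat S_n(s,t;g,\omega)=\tfrac14\int_0^4\Bigl[S_n\bigl(s,t;g-g(0)-\tfrac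 un,\omega\bigr)+\tfrac un\Bigr]du+g(0),$$ and extend $\hat S_n$ to real $s,t\ge0$ by bilinear interpolation on the squares of side $\frac1n$ with corners in $\frac1n\mathbb N^2$. **Space of evolutions.** Let $T>0$, $r=10+C_0+4T$, $q=2T+9$. Let $\mathcal E^r_q$ be the set of maps $F:\Gamma\to\Gamma$ such that: $F(g+m)=F(g)+m$ for every constant $m$; $F(g_1)\le F(g_2)$ whenever $g_1\le g_2$; $|F(g)(0)-g(0)|\le r$ for all $g$; and for every $R\ge q$, if $g_1=g_2$ on $\{|x|_1\le R\}$ then $F(g_1)=F(g_2)$ on $\{|x|_1\le R-q\}$. It carries the metric $$D(F_1,F_2)=\sum_{i\ge1}2^{-i}\frac{\|F_1-F_2\|_i}{1+\|F_1-F_2\|_i},\qquad \|F_1-F_2\|_i=\sup_{g\in\Gamma}\ \sup_{|x|_1\le i}|F_1(g)(x)-F_2(g)(x)|.$$ Let $\mathcal C_T=C([0,T]^2;\mathcal E^r_q)$ with the uniform metric $\sup_{s,t}D(R_1(s,t),R_2(s,t))$ and its Borel $\sigma$-algebra, and write $S(s,t;g)$ for $S(s,t)(g)$. Let $\mathcal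 C^0_T$ be the set of $S\in\mathcal C_T$ that are $(10+2C_0)$-Lipschitz for the $\ell_1$ metric on $[0,T]^2$ and satisfy: 1. $S(t_1,t_2;g)=g$ for all $g\in\Gamma$ and $t_1\ge t_2$ in $[0,T]$; 2. $S(t_2,t_3;S(t_1,t_2;g))=S(t_1,t_3;g)$ for all $g\in\Gamma$ and $0\le t_1\le t_2\le t_3\le T$; 3. for all $x\in\mathbb R^2$, $R\in\mathbb R$ and $g_1,g_2\in\Gamma$, if $g_1(y)=g_2(y)$ whenever $|y-x|_1\le R$, then $S(s,t;g_1)(y)=S(s,t;g_2)(y)$ whenever $0\le s<t\le T$ and $|y-x|_1\le R-2(t-s)$. **Proposition 5.1.** For every $n\ge1$ the evolution $\hat S_n$, restricted to $s,t\in[0,T]$, is a random element of $\mathcal C_T$; let $\mu_n$ be its law. If $(n_i)$ is a strictly increasing sequence of positive integers and $\mu_{n_i}$ converges weakly to a probability measure $\mu$ on $\mathcal C_T$, then $\mu$-almost every $S$ lies in $\mathcal C^0_T$. -/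

import Mathlib

open MeasureTheory Filter Topology

noncomputable section

namespace DominoShuffling

/-! ### Domino height functions and the shuffling height process -/

/-- Domino height functions on the faces of the square lattice, indexed by `ℤ × ℤ`.  The face
`(0, 0)` has a top-left black vertex, so a step from an even face (`i + j` even) to a horizontal
neighbour changes the height by `-1` or `3`, and a step to a vertical neighbour changes it by
`1` or `-3`.  The height is normalised by `φ (0, 0) ≡ 0 (mod 4)`.  (Around each vertex the four
changes, all read with a white vertex on the same side, lie in `{-1, 3}` and add up to `0`, so
that exactly one of the four edges at the vertex is a dimer.) -/
def IsAdmissible (φ : ℤ × ℤ → ℤ) : Prop :=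
  (4 : ℤ) ∣ φ (0, 0) ∧
  ∀ i j : ℤ, Even (i + j) →
    (φ (i + 1, j) = φ (i, j) - 1 ∨ φ (i + 1, j) = φ (i, j) + 3) ∧
    (φ (i - 1, j) = φ (i, j) - 1 ∨ φ (i - 1, j) = φ (i, j) + 3) ∧
    (φ (i, j + 1) = φ (i, j) + 1 ∨ φ (i, j + 1) = φ (i, j) - 3) ∧
    (φ (i, j - 1) = φ (i, j) + 1 ∨ φ (i, j - 1) = φ (i, j) - 3)

/-- The local rule: the new height at a face of height `h` whose upper, lower, left and right
neighbours have heights `U`, `D`, `L`, `R`.  The mark `b` matters only if no edge of the face is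
a dimer. -/
def localUpdate (h U D L R : ℤ) (b : Bool) : ℤ :=
  if U = h - 3 ∨ D = h - 3 then h - 4
  else if L = h + 3 ∨ R = h + 3 then h
  else if b = true then h - 4 else h

/-- First half of a shuffle: spider moves at all even faces. -/
def evenStep (φ : ℤ × ℤ → ℤ) (b : ℤ × ℤ → Bool) (z : ℤ × ℤ) : ℤ :=
  if Even (z.1 + z.2) then
    localUpdate (φ z) (φ (z.1, z.2 + 1)) (φ (z.1, z.2 - 1)) (φ (z.1 - 1, z.2))
      (φ (z.1 + 1, z.2)) (b z)
  else φ z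

/-- Second half of a shuffle: spider moves at all odd faces.  The heights at even faces in `φ`
have already been lowered by the global shift `-2` which is made at the end of a shuffle; the
rule at an odd face reads its neighbours before that shift, hence the `+ 2`. -/
def oddStep (φ : ℤ × ℤ → ℤ) (b : ℤ × ℤ → Bool) (z : ℤ × ℤ) : ℤ :=
  if Even (z.1 + z.2) then φ z
  else
    localUpdate (φ z) (φ (z.1, z.2 + 1) + 2) (φ (z.1, z.2 - 1) + 2) (φ (z.1 - 1, z.2) + 2)
      (φ (z.1 + 1, z.2) + 2) (b z)

/-- One shuffle with marks `b`. -/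
def shuffle (φ : ℤ × ℤ → ℤ) (b : ℤ × ℤ → Bool) : ℤ × ℤ → ℤ :=
  oddStep (evenStep φ b) b

/-- Collections of marks, one for each face and each time. -/
abbrev Marks : Type := (ℤ × ℤ) × ℕ → Bool

/-- The time translation of marks. -/
def timeShift (s : ℕ) (ω : Marks) : Marks := fun p => ω (p.1, p.2 + s)

/-- The height process `h(·, t; φ, ω)`; the shuffle that happens at time `t` uses the marks
`ω(·, t)`, `t = 1, 2, 3, …`. -/
def height (φ : ℤ × ℤ → ℤ) (ω : Marks) : ℕ → ℤ × ℤ → ℤ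
  | 0 => φ
  | t + 1 => shuffle (height φ ω t) (fun z => ω (z, t + 1))

/-- The probability `1 / (1 + a)` that a mark equals `1`. -/
def markProb (a : ℝ) (ha : 0 < a) : unitInterval :=
  ⟨1 / (1 + a), by
    have h : 0 < 1 + a := by linarith
    exact ⟨by positivity, by rw [div_le_one h]; linarith⟩⟩

/-- The law of i.i.d. Bernoulli marks: `1` (`true`) with probability `1 / (1 + a)` and
`0` (`false`) with probability `a / (1 + a)`. -/
def marksLaw (a : ℝ) (ha : 0 < a) : Measure Marks :=
  Measure.infinitePi
    (fun _ : (ℤ × ℤ) × ℕ => ProbabilityTheory.bernoulliMeasure true false (markProb a ha))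

instance (a : ℝ) (ha : 0 < a) : IsProbabilityMeasure (marksLaw a ha) := by
  unfold marksLaw; infer_instance

/-! ### Asymptotic height functions and the discrete evolution -/

/-- The `ℓ¹` norm on the plane. -/
def l1 (x : ℝ × ℝ) : ℝ := |x.1| + |x.2|

/-- The space `Γ` of asymptotic height functions: `2`-Lipschitz for the `ℓ^∞` norm. -/
def Asymp : Type :=
  {g : ℝ × ℝ → ℝ // ∀ x y : ℝ × ℝ, |g x - g y| ≤ 2 * max |x.1 - y.1| |x.2 - y.2|}

instance : CoeFun Asymp (fun _ => ℝ × ℝ → ℝ) := ⟨Subtype.val⟩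

/-- The pyramid height function: the minimum of the admissible height functions which vanish
at the origin. -/
def pyramid (z : ℤ × ℤ) : ℤ :=
  sInf {m : ℤ | ∃ φ : ℤ × ℤ → ℤ, IsAdmissible φ ∧ φ (0, 0) = 0 ∧ φ z = m}

/-- The admissible translates `τ_y v + k` of the pyramid with `k ≤ n g(y / n)`. -/
def belowProfile (n : ℕ) (g : ℝ × ℝ → ℝ) : Set (ℤ × ℤ → ℤ) :=
  {φ | IsAdmissible φ ∧ ∃ (y : ℤ × ℤ) (k : ℤ),
    (φ = fun z => pyramid (z - y) + k) ∧
    (k : ℝ) ≤ n * g ((y.1 : ℝ) / n, (y.2 : ℝ) / n)}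

/-- The initial height function `φ_g^n`, a pointwise maximum. -/
def initialHeight (n : ℕ) (g : ℝ × ℝ → ℝ) (z : ℤ × ℤ) : ℤ :=
  sSup {m : ℤ | ∃ φ ∈ belowProfile n g, φ z = m}

/-- Interpolation in the square `[0, 2]²` of the values at its corners (the subscripts are the
coordinates of the corners): the centre gets the mean of the largest and the smallest corner
value, and the function is affine on each of the four triangles cut out by the diagonals.
If the corner values lie in `{0, 4}`, this is `0` for equal values `0`, `2 min(x, y)` if only the
corner `(2, 2)` is high, `2 y` if `(0, 2)` and `(2, 2)` are high, `2 max(x, y)` if only `(0, 0)` is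
low, and, if `(2, 0)` and `(0, 2)` are high, `2 x`, `4 - 2 y`, `4 - 2 x`, `2 y` on the bottom, right,
top and left triangle. -/
def squareInterp (f00 f20 f22 f02 x y : ℝ) : ℝ :=
  let c := (max (max f00 f20) (max f22 f02) + min (min f00 f20) (min f22 f02)) / 2
  if y ≤ x then
    if y ≤ 2 - x then
      f00 + (f20 - f00) / 2 * x + (c - (f00 + f20) / 2) * y
    else
      f20 + (f22 - f20) / 2 * y + (c - (f20 + f22) / 2) * (2 - x)
  else
    if y ≤ 2 - x then
      f00 + (f02 - f00) / 2 * y + (c - (f00 + f02) / 2) * x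
    else
      f02 + (f22 - f02) / 2 * x + (c - (f02 + f22) / 2) * (2 - y)

theorem squareInterp_center (f00 f20 f22 f02 : ℝ) :
    squareInterp f00 f20 f22 f02 1 1 =
      (max (max f00 f20) (max f22 f02) + min (min f00 f20) (min f22 f02)) / 2 := by
  unfold squareInterp
  rw [if_pos le_rfl, if_pos (by norm_num)]
  ring

/-- The extension to the plane of the restriction of a height function to `2ℤ²`. -/
def interp (φ : ℤ × ℤ → ℤ) (x : ℝ × ℝ) : ℝ :=
  let i : ℤ := ⌊x.1 / 2⌋
  let j : ℤ := ⌊x.2 / 2⌋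
  squareInterp (φ (2 * i, 2 * j)) (φ (2 * i + 2, 2 * j)) (φ (2 * i + 2, 2 * j + 2))
    (φ (2 * i, 2 * j + 2)) (x.1 - 2 * i) (x.2 - 2 * j)

/-- `C₀` bounds the distance between a height function and the interpolation of its restriction
to `2ℤ²`, at all lattice points. -/
def IsInterpBound (C₀ : ℝ) : Prop :=
  ∀ φ : ℤ × ℤ → ℤ, IsAdmissible φ → ∀ z : ℤ × ℤ,
    |interp φ ((z.1 : ℝ), (z.2 : ℝ)) - φ z| < C₀

/-- Such constants exist: `4` is one. -/
theorem isInterpBound_four : IsInterpBound 4 := by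
  intro φ hφ z
  obtain ⟨a, b⟩ := z
  obtain ⟨-, hφ⟩ := hφ
  have floor_even : ∀ i : ℤ, ⌊((2 * i : ℤ) : ℝ) / 2⌋ = i := fun i => by
    rw [Int.floor_eq_iff]; push_cast; constructor <;> linarith
  have floor_odd : ∀ i : ℤ, ⌊((2 * i + 1 : ℤ) : ℝ) / 2⌋ = i := fun i => by
    rw [Int.floor_eq_iff]; push_cast; constructor <;> linarith
  rcases Int.even_or_odd' a with ⟨i, rfl | rfl⟩ <;> rcases Int.even_or_odd' b with ⟨j, rfl | rfl⟩ <;>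
    simp only [interp, floor_even, floor_odd]
  · norm_num [squareInterp]
  · have h1 := (hφ (2 * i) (2 * j) (by rw [Int.even_iff]; omega)).2.2.1
    have h2 := (hφ (2 * i) (2 * j + 2) (by rw [Int.even_iff]; omega)).2.2.2
    rw [show 2 * j + 2 - 1 = 2 * j + 1 by ring] at h2
    norm_num [squareInterp]
    rw [abs_lt]
    rcases h1 with h1 | h1 <;> rcases h2 with h2 | h2 <;>
      (have e1 : (φ (2 * i, 2 * j + 1) : ℝ) = _ := congrArg Int.cast h1
       have e2 : (φ (2 * i, 2 * j + 1) : ℝ) = _ := congrArg Int.cast h2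
       push_cast at e1 e2
       constructor <;> linarith)
  · have h1 := (hφ (2 * i) (2 * j) (by rw [Int.even_iff]; omega)).1
    have h2 := (hφ (2 * i + 2) (2 * j) (by rw [Int.even_iff]; omega)).2.1
    rw [show 2 * i + 2 - 1 = 2 * i + 1 by ring] at h2
    norm_num [squareInterp]
    rw [abs_lt]
    rcases h1 with h1 | h1 <;> rcases h2 with h2 | h2 <;>
      (have e1 : (φ (2 * i + 1, 2 * j) : ℝ) = _ := congrArg Int.cast h1
       have e2 : (φ (2 * i + 1, 2 * j) : ℝ) = _ := congrArg Int.cast h2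
       push_cast at e1 e2
       constructor <;> linarith)
  · obtain ⟨c1, c2, c3, c4⟩ := hφ (2 * i + 1) (2 * j + 1) (by rw [Int.even_iff]; omega)
    obtain ⟨p1, -, p3, -⟩ := hφ (2 * i) (2 * j) (by rw [Int.even_iff]; omega)
    obtain ⟨-, q2, q3, -⟩ := hφ (2 * i + 2) (2 * j) (by rw [Int.even_iff]; omega)
    obtain ⟨-, r2, -, r4⟩ := hφ (2 * i + 2) (2 * j + 2) (by rw [Int.even_iff]; omega)
    obtain ⟨s1, -, -, s4⟩ := hφ (2 * i) (2 * j + 2) (by rw [Int.even_iff]; omega)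
    rw [show 2 * i + 1 + 1 = 2 * i + 2 by ring] at c1
    rw [show 2 * i + 1 - 1 = 2 * i by ring] at c2
    rw [show 2 * j + 1 + 1 = 2 * j + 2 by ring] at c3
    rw [show 2 * j + 1 - 1 = 2 * j by ring] at c4
    rw [show 2 * i + 2 - 1 = 2 * i + 1 by ring] at q2 r2
    rw [show 2 * j + 2 - 1 = 2 * j + 1 by ring] at r4 s4
    have key : ∀ m : ℤ, m ≤ φ (2 * i + 1, 2 * j + 1) + 2 ∧ φ (2 * i + 1, 2 * j + 1) - 2 ≤ m →
        (m : ℝ) ≤ φ (2 * i + 1, 2 * j + 1) + 2 ∧ (φ (2 * i + 1, 2 * j + 1) : ℝ) - 2 ≤ m :=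
      fun m h => ⟨by exact_mod_cast h.1, by exact_mod_cast h.2⟩
    have k1 := key (φ (2 * i, 2 * j)) (by omega)
    have k2 := key (φ (2 * i + 2, 2 * j)) (by omega)
    have k3 := key (φ (2 * i + 2, 2 * j + 2)) (by omega)
    have k4 := key (φ (2 * i, 2 * j + 2)) (by omega)
    have u1 := max_le (max_le k1.1 k2.1) (max_le k3.1 k4.1)
    have u2 := le_min (le_min k1.2 k2.2) (le_min k3.2 k4.2)
    have u3 := k1.1.trans' ((min_le_left _ _).trans (min_le_left _ _) :
      min (min (φ (2 * i, 2 * j) : ℝ) (φ (2 * i + 2, 2 * j)))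
        (min (φ (2 * i + 2, 2 * j + 2) : ℝ) (φ (2 * i, 2 * j + 2))) ≤ φ (2 * i, 2 * j))
    have u4 := k1.2.trans ((le_max_left _ _).trans (le_max_left _ _) :
      (φ (2 * i, 2 * j) : ℝ) ≤ max (max (φ (2 * i, 2 * j) : ℝ) (φ (2 * i + 2, 2 * j)))
        (max (φ (2 * i + 2, 2 * j + 2) : ℝ) (φ (2 * i, 2 * j + 2))))
    push_cast
    rw [show (2 * (i : ℝ) + 1 - 2 * i) = 1 by ring, show (2 * (j : ℝ) + 1 - 2 * j) = 1 by ring,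
      squareInterp_center, abs_lt]
    constructor <;> linarith

/-- The rescaled evolution `S_n(k / n, l / n; g, ω)`. -/
def discreteS (n k l : ℕ) (g : ℝ × ℝ → ℝ) (ω : Marks) (x : ℝ × ℝ) : ℝ :=
  if k < l then
    1 / (n : ℝ) *
      interp (height (initialHeight n g) (timeShift k ω) (l - k)) (n * x.1, n * x.2)
  else g x

/-- The averaged evolution `Ŝ_n(k / n, l / n; g, ω)`. -/
def averagedS (n k l : ℕ) (g : ℝ × ℝ → ℝ) (ω : Marks) (x : ℝ × ℝ) : ℝ :=
  1 / 4 * (∫ u in (0 : ℝ)..4,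
      (discreteS n k l (fun y => g y - g (0, 0) - u / n) ω x + u / n)) + g (0, 0)

/-- The evolution `Ŝ_n(s, t; g, ω)` at real times `s, t ≥ 0`, by bilinear interpolation of the
values at `s, t ∈ (1 / n) ℕ`. -/
def hatS (n : ℕ) (s t : ℝ) (g : ℝ × ℝ → ℝ) (ω : Marks) (x : ℝ × ℝ) : ℝ :=
  let k := ⌊(n : ℝ) * s⌋₊
  let l := ⌊(n : ℝ) * t⌋₊
  let α : ℝ := n * s - k
  let β : ℝ := n * t - l
  let f00 := averagedS n k l g ω x
  let f10 := averagedS n (k + 1) l g ω x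
  let f01 := averagedS n k (l + 1) g ω x
  let f11 := averagedS n (k + 1) (l + 1) g ω x
  f00 + (f10 - f00) * α + (f01 - f00) * β + (f00 + f11 - f01 - f10) * (α * β)

/-! ### The space of continuous evolutions -/

/-- The space `E^r_q` of maps `F : Γ → Γ` which commute with adding constants, are monotone,
move the value at the origin by at most `r`, and have range of dependence at most `q` around the
origin. -/
structure Evol (r q : ℝ) where
  toFun : Asymp → Asymp
  add_const' : ∀ (g g' : Asymp) (m : ℝ), (∀ x, g' x = g x + m) →
    ∀ x, toFun g' x = toFun g x + m
  mono' : ∀ g₁ g₂ : Asymp, (∀ x, g₁ x ≤ g₂ x) → ∀ x, toFun g₁ x ≤ toFun g₂ x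
  bound' : ∀ g : Asymp, |toFun g (0, 0) - g (0, 0)| ≤ r
  local' : ∀ (g₁ g₂ : Asymp) (R : ℝ), q ≤ R → (∀ x, l1 x ≤ R → g₁ x = g₂ x) →
    ∀ x, l1 x ≤ R - q → toFun g₁ x = toFun g₂ x

instance (r q : ℝ) : CoeFun (Evol r q) (fun _ => Asymp → Asymp) := ⟨Evol.toFun⟩

/-- `‖f‖_k`, the supremum of `|f|` over the `ℓ¹` ball of radius `k`. -/
def ballSup (k : ℕ) (f : ℝ × ℝ → ℝ) : ℝ := ⨆ x : {x : ℝ × ℝ // l1 x ≤ k}, |f x|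

/-- `‖F₁ - F₂‖_k`, the supremum of `‖F₁(g) - F₂(g)‖_k` over `g ∈ Γ`. -/
def evolSup {r q : ℝ} (k : ℕ) (F₁ F₂ : Evol r q) : ℝ :=
  ⨆ g : Asymp, ballSup k (fun x => F₁ g x - F₂ g x)

/-- The distance `D` on `E^r_q`. -/
def evolDist {r q : ℝ} (F₁ F₂ : Evol r q) : ℝ :=
  ∑' i : ℕ, (1 / 2 : ℝ) ^ (i + 1) * (evolSup (i + 1) F₁ F₂ / (1 + evolSup (i + 1) F₁ F₂))

section Metric

variable {r q : ℝ}

instance : Nonempty Asymp := ⟨⟨fun _ => 0, fun x y => by simp⟩⟩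

instance (k : ℕ) : Nonempty {x : ℝ × ℝ // l1 x ≤ k} := ⟨⟨(0, 0), by simp [l1]⟩⟩

theorem abs_sub_le_of_ball (F₁ F₂ : Evol r q) (g : Asymp) (k : ℕ) (x : ℝ × ℝ)
    (hx : l1 x ≤ k) : |F₁ g x - F₂ g x| ≤ 2 * r + 4 * k := by
  have h1 := (F₁ g).2 x (0, 0)
  have h2 := (F₂ g).2 x (0, 0)
  have h3 := F₁.bound' g
  have h4 := F₂.bound' g
  have hm : max |x.1 - 0| |x.2 - 0| ≤ (k : ℝ) := by
    have e1 := abs_nonneg x.1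
    have e2 := abs_nonneg x.2
    simp only [l1] at hx
    simp only [sub_zero]
    exact max_le (by linarith) (by linarith)
  simp only at h1 h2
  rw [abs_le] at *
  constructor <;> linarith [h1.1, h1.2, h2.1, h2.2, h3.1, h3.2, h4.1, h4.2]

theorem ballSup_bdd (F₁ F₂ : Evol r q) (g : Asymp) (k : ℕ) :
    BddAbove (Set.range fun x : {x : ℝ × ℝ // l1 x ≤ k} => |F₁ g x - F₂ g x|) :=
  ⟨2 * r + 4 * k, by rintro _ ⟨x, rfl⟩; exact abs_sub_le_of_ball F₁ F₂ g k x x.2⟩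

theorem ballSup_le (F₁ F₂ : Evol r q) (g : Asymp) (k : ℕ) :
    ballSup k (fun x => F₁ g x - F₂ g x) ≤ 2 * r + 4 * k :=
  ciSup_le fun x => abs_sub_le_of_ball F₁ F₂ g k x x.2

theorem evolSup_bdd (F₁ F₂ : Evol r q) (k : ℕ) :
    BddAbove (Set.range fun g : Asymp => ballSup k (fun x => F₁ g x - F₂ g x)) :=
  ⟨2 * r + 4 * k, by rintro _ ⟨g, rfl⟩; exact ballSup_le F₁ F₂ g k⟩

theorem abs_le_evolSup (F₁ F₂ : Evol r q) (g : Asymp) (k : ℕ) (x : ℝ × ℝ) (hx : l1 x ≤ k) :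
    |F₁ g x - F₂ g x| ≤ evolSup k F₁ F₂ :=
  (le_ciSup (ballSup_bdd F₁ F₂ g k) ⟨x, hx⟩).trans (le_ciSup (evolSup_bdd F₁ F₂ k) g)

theorem evolSup_le (F₁ F₂ : Evol r q) (k : ℕ) (c : ℝ)
    (h : ∀ (g : Asymp) (x : ℝ × ℝ), l1 x ≤ k → |F₁ g x - F₂ g x| ≤ c) :
    evolSup k F₁ F₂ ≤ c :=
  ciSup_le fun g => ciSup_le fun x => h g x x.2

theorem evolSup_nonneg (F₁ F₂ : Evol r q) (k : ℕ) : 0 ≤ evolSup k F₁ F₂ :=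
  (abs_nonneg _).trans
    (abs_le_evolSup F₁ F₂ (Classical.arbitrary _) k (0, 0) (by simp [l1]))

theorem evolSup_self (F : Evol r q) (k : ℕ) : evolSup k F F = 0 :=
  le_antisymm (evolSup_le F F k 0 fun g x _ => by simp) (evolSup_nonneg F F k)

theorem evolSup_comm (F₁ F₂ : Evol r q) (k : ℕ) : evolSup k F₁ F₂ = evolSup k F₂ F₁ := by
  simp only [evolSup, ballSup, abs_sub_comm]

theorem evolSup_triangle (F₁ F₂ F₃ : Evol r q) (k : ℕ) :
    evolSup k F₁ F₃ ≤ evolSup k F₁ F₂ + evolSup k F₂ F₃ :=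
  evolSup_le _ _ _ _ fun g x hx =>
    (abs_sub_le _ (F₂ g x) _).trans
      (add_le_add (abs_le_evolSup F₁ F₂ g k x hx) (abs_le_evolSup F₂ F₃ g k x hx))

theorem frac_le_one {a : ℝ} (ha : 0 ≤ a) : a / (1 + a) ≤ 1 := by
  rw [div_le_one (by linarith)]; linarith

theorem frac_triangle {a b c : ℝ} (ha : 0 ≤ a) (hb : 0 ≤ b) (hc : 0 ≤ c) (h : a ≤ b + c) :
    a / (1 + a) ≤ b / (1 + b) + c / (1 + c) := by
  have h1 : a / (1 + a) ≤ (b + c) / (1 + (b + c)) := by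
    rw [div_le_div_iff₀ (by linarith) (by linarith)]; nlinarith
  have h2 : b / (1 + (b + c)) ≤ b / (1 + b) :=
    div_le_div_of_nonneg_left hb (by linarith) (by linarith)
  have h3 : c / (1 + (b + c)) ≤ c / (1 + c) :=
    div_le_div_of_nonneg_left hc (by linarith) (by linarith)
  rw [add_div] at h1
  linarith

theorem evolDist_term_nonneg (F₁ F₂ : Evol r q) (i : ℕ) :
    0 ≤ (1 / 2 : ℝ) ^ (i + 1) * (evolSup (i + 1) F₁ F₂ / (1 + evolSup (i + 1) F₁ F₂)) := by
  have := evolSup_nonneg F₁ F₂ (i + 1)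
  positivity

theorem evolDist_summable (F₁ F₂ : Evol r q) :
    Summable fun i : ℕ =>
      (1 / 2 : ℝ) ^ (i + 1) * (evolSup (i + 1) F₁ F₂ / (1 + evolSup (i + 1) F₁ F₂)) := by
  refine Summable.of_nonneg_of_le (evolDist_term_nonneg F₁ F₂) (fun i => ?_)
    ((summable_nat_add_iff 1).2 summable_geometric_two)
  exact mul_le_of_le_one_right (by positivity) (frac_le_one (evolSup_nonneg F₁ F₂ _))

theorem evol_ext {F₁ F₂ : Evol r q} (h : ∀ (g : Asymp) (x : ℝ × ℝ), F₁ g x = F₂ g x) :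
    F₁ = F₂ := by
  have e : F₁.toFun = F₂.toFun := funext fun g => Subtype.ext (funext fun x => h g x)
  cases F₁
  cases F₂
  cases e
  rfl

/-- `E^r_q` with the distance `D` is a metric space. -/
instance : MetricSpace (Evol r q) where
  dist := evolDist
  dist_self F := by
    simp [evolDist, evolSup_self]
  dist_comm F₁ F₂ := by
    simp only [evolDist, evolSup_comm F₁ F₂]
  dist_triangle F₁ F₂ F₃ := by
    unfold evolDist
    rw [← (evolDist_summable F₁ F₂).tsum_add (evolDist_summable F₂ F₃)]
    refine (evolDist_summable F₁ F₃).tsum_le_tsum (fun i => ?_)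
      ((evolDist_summable F₁ F₂).add (evolDist_summable F₂ F₃))
    rw [← mul_add]
    exact mul_le_mul_of_nonneg_left
      (frac_triangle (evolSup_nonneg _ _ _) (evolSup_nonneg _ _ _) (evolSup_nonneg _ _ _)
        (evolSup_triangle _ _ _ _)) (by positivity)
  eq_of_dist_eq_zero {F₁ F₂} h := by
    change evolDist F₁ F₂ = 0 at h
    refine evol_ext fun g x => ?_
    obtain ⟨k, hk⟩ := exists_nat_ge (l1 x)
    have hs := (evolDist_summable F₁ F₂).hasSum
    change HasSum _ (evolDist F₁ F₂) at hs
    rw [h] at hs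
    have h0 := congrFun ((hasSum_zero_iff_of_nonneg (evolDist_term_nonneg F₁ F₂)).1 hs) k
    have hn := evolSup_nonneg F₁ F₂ (k + 1)
    have hz : evolSup (k + 1) F₁ F₂ = 0 := by
      simp only [Pi.zero_apply, mul_eq_zero, div_eq_zero_iff] at h0
      rcases h0 with h0 | h0 | h0
      · exact absurd h0 (by positivity)
      · exact h0
      · linarith
    have hx := abs_le_evolSup F₁ F₂ g (k + 1) x (by push_cast; linarith)
    rw [hz] at hx
    exact sub_eq_zero.1 (abs_nonpos_iff.1 hx)

end Metric

/-- The space `C_T` of continuous maps `[0, T]² → E^r_q`, where `r = 10 + C₀ + 4 T` and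
`q = 2 T + 9`, with the metric of uniform convergence. -/
abbrev CT (T C₀ : ℝ) : Type :=
  C(Set.Icc (0 : ℝ) T × Set.Icc (0 : ℝ) T, Evol (10 + C₀ + 4 * T) (2 * T + 9))

instance (T C₀ : ℝ) : MeasurableSpace (CT T C₀) := borel _

instance (T C₀ : ℝ) : BorelSpace (CT T C₀) := ⟨rfl⟩

/-- The subset `C'_T` of evolutions which are `(10 + 2 C₀)`-Lipschitz for the `ℓ¹` metric on
`[0, T]²`. -/
def CTLip (T C₀ : ℝ) : Set (CT T C₀) :=
  {S | ∀ s t s' t' : Set.Icc (0 : ℝ) T,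
    dist (S (s, t)) (S (s', t')) ≤
      (10 + 2 * C₀) * (|(s : ℝ) - s'| + |(t : ℝ) - t'|)}

/-- The subset `C⁰_T` of `C'_T`: evolutions which are the identity for `t₁ ≥ t₂`, satisfy the
semigroup law, and propagate information at speed at most `2` in `ℓ¹`. -/
def CTZero (T C₀ : ℝ) : Set (CT T C₀) :=
  {S | S ∈ CTLip T C₀ ∧
    (∀ (g : Asymp) (t₁ t₂ : Set.Icc (0 : ℝ) T), t₂ ≤ t₁ → S (t₁, t₂) g = g) ∧
    (∀ (g : Asymp) (t₁ t₂ t₃ : Set.Icc (0 : ℝ) T), t₁ ≤ t₂ → t₂ ≤ t₃ →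
      S (t₂, t₃) (S (t₁, t₂) g) = S (t₁, t₃) g) ∧
    (∀ (x : ℝ × ℝ) (R : ℝ) (g₁ g₂ : Asymp), (∀ y, l1 (y - x) ≤ R → g₁ y = g₂ y) →
      ∀ s t : Set.Icc (0 : ℝ) T, s < t →
        ∀ y, l1 (y - x) ≤ R - 2 * ((t : ℝ) - s) → S (s, t) g₁ y = S (s, t) g₂ y)}

/-- The law `μ` of a random element `X` of `C_T` defined on the space of marks. -/
def evolLaw {T C₀ : ℝ} (a : ℝ) (ha : 0 < a) (X : Marks → CT T C₀) (hX : Measurable X) :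
    ProbabilityMeasure (CT T C₀) :=
  ⟨(marksLaw a ha).map X, Measure.isProbabilityMeasure_map hX.aemeasurable⟩

end DominoShuffling

end

open DominoShuffling

/-!
The randomness plays almost no role.  For every configuration of marks, `Ŝ_n` satisfies all the
conditions that define `C⁰_T`, some of them up to an error of order `1 / n`:

* it is `12`-Lipschitz in the times (`abs_hatS_time_sub_le`), since a shuffle lowers a height by
  `0` or `4` and rounding costs a bounded amount; and `12 ≤ 10 + 2 C₀`;
* it is within `12 / n` of the identity if `t ≤ s` (`abs_hatS_sub_self_le`);
* it satisfies the semigroup law up to `96 / n` (`abs_hatS_hatS_sub_le`), since the height process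
  is a cocycle that is monotone and commutes with constants, so that the rounding of the
  intermediate profile is not amplified;
* its value at `x` depends only on the profile in the `ℓ¹` ball of radius `2 (t - s) + 9 / n` around
  `x` (`hatEvol_local`), since a shuffle has range `2`.

These statements are preserved, and become exact, under convergence in `C_T`
(`mem_CTZero_of_tendsto`).  For the semigroup law this uses that elements of `E^r_q` are
equicontinuous for locally uniform convergence: they are nonexpansive for the uniform distance and
local, so a profile may be truncated far away.  By the portmanteau theorem for the closures of the sets of
values of `Ŝ_n`, `n ≥ N`, almost every point for a weak limit of the laws is a limit of values of
`Ŝ_{n_j}` with `n_j → ∞` (`ae_mem_closure_of_tendsto`).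

The lattice part rests on closed formulas.  The pyramid is `-2 |z|_∞` at even faces
(`pyramid_eq`), whence `φ_g^n` is `n g(z / n)` rounded down in the residue class of `z` at even
faces, and is determined by the even neighbours at odd faces (`initialHeight_eq`).  The
initial height is therefore local, monotone and close to the profile, and it commutes with adding `4 m`.  The last
property makes the integrand of the average over `u` periodic, so that `Ŝ_n` commutes with all real
constants although it is normalised at the origin (`averagedS_eq`).  Measurability
holds because `Ŝ_n` is continuous in the marks: on a ball, it is determined by finitely many of
them.
-/

namespace DominoShuffling

noncomputable section

/-! ### The local rule and the height process -/

/-- Two admissible height functions agree modulo `4` at every face. -/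
theorem IsAdmissible.dvd_sub {φ ψ : ℤ × ℤ → ℤ} (hφ : IsAdmissible φ) (hψ : IsAdmissible ψ)
    (z : ℤ × ℤ) : 4 ∣ φ z - ψ z := by
  have hor : ∀ i j : ℤ, 4 ∣ (φ (i + 1, j) - ψ (i + 1, j)) - (φ (i, j) - ψ (i, j)) := by
    intro i j
    rcases Int.even_or_odd (i + j) with h | h
    · have h1 := (hφ.2 i j h).1
      have h2 := (hψ.2 i j h).1
      omega
    · have h' : Even (i + 1 + j) := by rw [add_right_comm]; exact h.add_one
      have h1 := (hφ.2 (i + 1) j h').2.1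
      have h2 := (hψ.2 (i + 1) j h').2.1
      rw [add_sub_cancel_right] at h1 h2
      omega
  have ver : ∀ i j : ℤ, 4 ∣ (φ (i, j + 1) - ψ (i, j + 1)) - (φ (i, j) - ψ (i, j)) := by
    intro i j
    rcases Int.even_or_odd (i + j) with h | h
    · have h1 := (hφ.2 i j h).2.2.1
      have h2 := (hψ.2 i j h).2.2.1
      omega
    · have h' : Even (i + (j + 1)) := by rw [← add_assoc]; exact h.add_one
      have h1 := (hφ.2 i (j + 1) h').2.2.2
      have h2 := (hψ.2 i (j + 1) h').2.2.2
      rw [add_sub_cancel_right] at h1 h2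
      omega
  have row : ∀ i : ℤ, 4 ∣ φ (i, 0) - ψ (i, 0) := by
    intro i
    induction i using Int.induction_on with
    | zero =>
      have h1 := hφ.1
      have h2 := hψ.1
      omega
    | succ i ih =>
      have := hor i 0
      omega
    | pred i ih =>
      have := hor (-i - 1) 0
      rw [sub_add_cancel] at this
      omega
  obtain ⟨i, j⟩ := z
  induction j using Int.induction_on with
  | zero => exact row i
  | succ j ih =>
    have := ver i j
    omega
  | pred j ih =>
    have := ver i (-j - 1)
    rw [sub_add_cancel] at this
    omega

theorem localUpdate_eq_or (h U D L R : ℤ) (b : Bool) :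
    localUpdate h U D L R b = h ∨ localUpdate h U D L R b = h - 4 := by
  unfold localUpdate
  split_ifs <;> simp

theorem localUpdate_add (h U D L R m : ℤ) (b : Bool) :
    localUpdate (h + m) (U + m) (D + m) (L + m) (R + m) b = localUpdate h U D L R b + m := by
  unfold localUpdate
  split_ifs <;> omega

/-- The local rule is monotone: at equal heights, a higher neighbourhood can only prevent the
height from being lowered, and otherwise the heights differ by at least `4`. -/
theorem localUpdate_mono {h U D L R h' U' D' L' R' : ℤ} (b : Bool) (hh : 4 ∣ h' - h)
    (hU : U = h + 1 ∨ U = h - 3) (hD : D = h + 1 ∨ D = h - 3)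
    (hL' : L' = h' - 1 ∨ L' = h' + 3) (hR' : R' = h' - 1 ∨ R' = h' + 3)
    (le : h ≤ h') (leU : U ≤ U') (leD : D ≤ D') (leL : L ≤ L') (leR : R ≤ R') :
    localUpdate h U D L R b ≤ localUpdate h' U' D' L' R' b := by
  unfold localUpdate
  split_ifs <;> omega

/-- The local rule exchanges the roles of horizontal and vertical neighbours.  The heights
`a₁, …, a₄` at the upper left, upper right, lower left and lower right corner exclude that a
vertical and a horizontal edge of the face are both dimers. -/
theorem localUpdate_flip {h U D L R a₁ a₂ a₃ a₄ : ℤ} (b : Bool)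
    (hU : U = h + 1 ∨ U = h - 3) (hD : D = h + 1 ∨ D = h - 3)
    (hL : L = h - 1 ∨ L = h + 3) (hR : R = h - 1 ∨ R = h + 3)
    (h1U : U = a₁ - 1 ∨ U = a₁ + 3) (h1L : L = a₁ + 1 ∨ L = a₁ - 3)
    (h2U : U = a₂ - 1 ∨ U = a₂ + 3) (h2R : R = a₂ + 1 ∨ R = a₂ - 3)
    (h3D : D = a₃ - 1 ∨ D = a₃ + 3) (h3L : L = a₃ + 1 ∨ L = a₃ - 3)
    (h4D : D = a₄ - 1 ∨ D = a₄ + 3) (h4R : R = a₄ + 1 ∨ R = a₄ - 3) :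
    ((L = localUpdate h U D L R b + 3 ∨ L = localUpdate h U D L R b - 1) ∧
      (R = localUpdate h U D L R b + 3 ∨ R = localUpdate h U D L R b - 1)) ∧
    ((U = localUpdate h U D L R b + 1 ∨ U = localUpdate h U D L R b + 5) ∧
      (D = localUpdate h U D L R b + 1 ∨ D = localUpdate h U D L R b + 5)) := by
  have e1 : ¬(U = h - 3 ∧ L = h + 3) := by omega
  have e2 : ¬(U = h - 3 ∧ R = h + 3) := by omega
  have e3 : ¬(D = h - 3 ∧ L = h + 3) := by omega
  have e4 : ¬(D = h - 3 ∧ R = h + 3) := by omega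
  clear h1U h1L h2U h2R h3D h3L h4D h4R
  unfold localUpdate
  rcases hU with rfl | rfl <;> rcases hD with rfl | rfl <;> rcases hL with rfl | rfl <;>
    rcases hR with rfl | rfl <;> (split_ifs <;> omega)

/-- The local condition satisfied between the two halves of a shuffle: with the shift by `2` at
even faces, it is the condition of admissibility with the parities exchanged. -/
def IsFlipped (φ : ℤ × ℤ → ℤ) : Prop :=
  ∀ i j : ℤ, Odd (i + j) →
    (φ (i + 1, j) + 2 = φ (i, j) - 1 ∨ φ (i + 1, j) + 2 = φ (i, j) + 3) ∧
    (φ (i - 1, j) + 2 = φ (i, j) - 1 ∨ φ (i - 1, j) + 2 = φ (i, j) + 3) ∧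
    (φ (i, j + 1) + 2 = φ (i, j) + 1 ∨ φ (i, j + 1) + 2 = φ (i, j) - 3) ∧
    (φ (i, j - 1) + 2 = φ (i, j) + 1 ∨ φ (i, j - 1) + 2 = φ (i, j) - 3)

theorem evenStep_of_even {φ : ℤ × ℤ → ℤ} {b : ℤ × ℤ → Bool} {i j : ℤ} (h : Even (i + j)) :
    evenStep φ b (i, j) = localUpdate (φ (i, j)) (φ (i, j + 1)) (φ (i, j - 1)) (φ (i - 1, j))
      (φ (i + 1, j)) (b (i, j)) := if_pos h

theorem evenStep_of_odd {φ : ℤ × ℤ → ℤ} {b : ℤ × ℤ → Bool} {i j : ℤ} (h : Odd (i + j)) :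
    evenStep φ b (i, j) = φ (i, j) := if_neg (Int.not_even_iff_odd.2 h)

theorem oddStep_of_even {φ : ℤ × ℤ → ℤ} {b : ℤ × ℤ → Bool} {i j : ℤ} (h : Even (i + j)) :
    oddStep φ b (i, j) = φ (i, j) := if_pos h

theorem oddStep_of_odd {φ : ℤ × ℤ → ℤ} {b : ℤ × ℤ → Bool} {i j : ℤ} (h : Odd (i + j)) :
    oddStep φ b (i, j) = localUpdate (φ (i, j)) (φ (i, j + 1) + 2) (φ (i, j - 1) + 2)
      (φ (i - 1, j) + 2) (φ (i + 1, j) + 2) (b (i, j)) := if_neg (Int.not_even_iff_odd.2 h)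

theorem IsAdmissible.evenStep_neighbours {φ : ℤ × ℤ → ℤ} (hφ : IsAdmissible φ) (b : ℤ × ℤ → Bool)
    {i j : ℤ} (h : Even (i + j)) :
    ((φ (i - 1, j) = evenStep φ b (i, j) + 3 ∨ φ (i - 1, j) = evenStep φ b (i, j) - 1) ∧
      (φ (i + 1, j) = evenStep φ b (i, j) + 3 ∨ φ (i + 1, j) = evenStep φ b (i, j) - 1)) ∧
    ((φ (i, j + 1) = evenStep φ b (i, j) + 1 ∨ φ (i, j + 1) = evenStep φ b (i, j) + 5) ∧
      (φ (i, j - 1) = evenStep φ b (i, j) + 1 ∨ φ (i, j - 1) = evenStep φ b (i, j) + 5)) := by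
  rw [evenStep_of_even h]
  obtain ⟨hR, hL, hU, hD⟩ := hφ.2 i j h
  obtain ⟨p1, -, -, p2⟩ := hφ.2 (i - 1) (j + 1) (by rw [Int.even_iff] at *; omega)
  obtain ⟨-, q1, -, q2⟩ := hφ.2 (i + 1) (j + 1) (by rw [Int.even_iff] at *; omega)
  obtain ⟨r1, -, r2, -⟩ := hφ.2 (i - 1) (j - 1) (by rw [Int.even_iff] at *; omega)
  obtain ⟨-, s1, s2, -⟩ := hφ.2 (i + 1) (j - 1) (by rw [Int.even_iff] at *; omega)
  simp only [sub_add_cancel, add_sub_cancel_right] at p1 p2 q1 q2 r1 r2 s1 s2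
  exact localUpdate_flip _ hU hD hL hR p1 p2 q1 q2 r1 r2 s1 s2

theorem IsAdmissible.isFlipped_evenStep {φ : ℤ × ℤ → ℤ} (hφ : IsAdmissible φ)
    (b : ℤ × ℤ → Bool) : IsFlipped (evenStep φ b) := by
  intro i j h
  rw [evenStep_of_odd h]
  have e1 := (hφ.evenStep_neighbours b (i := i + 1) (j := j)
    (by rw [Int.odd_iff] at h; rw [Int.even_iff]; omega)).1.1
  have e2 := (hφ.evenStep_neighbours b (i := i - 1) (j := j)
    (by rw [Int.odd_iff] at h; rw [Int.even_iff]; omega)).1.2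
  have e3 := (hφ.evenStep_neighbours b (i := i) (j := j + 1)
    (by rw [Int.odd_iff] at h; rw [Int.even_iff]; omega)).2.2
  have e4 := (hφ.evenStep_neighbours b (i := i) (j := j - 1)
    (by rw [Int.odd_iff] at h; rw [Int.even_iff]; omega)).2.1
  simp only [sub_add_cancel, add_sub_cancel_right] at e1 e2 e3 e4
  omega

theorem IsFlipped.oddStep_neighbours {φ : ℤ × ℤ → ℤ} (hφ : IsFlipped φ) (b : ℤ × ℤ → Bool)
    {i j : ℤ} (h : Odd (i + j)) :
    ((φ (i - 1, j) + 2 = oddStep φ b (i, j) + 3 ∨ φ (i - 1, j) + 2 = oddStep φ b (i, j) - 1) ∧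
      (φ (i + 1, j) + 2 = oddStep φ b (i, j) + 3 ∨
        φ (i + 1, j) + 2 = oddStep φ b (i, j) - 1)) ∧
    ((φ (i, j + 1) + 2 = oddStep φ b (i, j) + 1 ∨ φ (i, j + 1) + 2 = oddStep φ b (i, j) + 5) ∧
      (φ (i, j - 1) + 2 = oddStep φ b (i, j) + 1 ∨
        φ (i, j - 1) + 2 = oddStep φ b (i, j) + 5)) := by
  rw [oddStep_of_odd h]
  obtain ⟨hR, hL, hU, hD⟩ := hφ i j h
  obtain ⟨p1, -, -, p2⟩ := hφ (i - 1) (j + 1) (by rw [Int.odd_iff] at *; omega)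
  obtain ⟨-, q1, -, q2⟩ := hφ (i + 1) (j + 1) (by rw [Int.odd_iff] at *; omega)
  obtain ⟨r1, -, r2, -⟩ := hφ (i - 1) (j - 1) (by rw [Int.odd_iff] at *; omega)
  obtain ⟨-, s1, s2, -⟩ := hφ (i + 1) (j - 1) (by rw [Int.odd_iff] at *; omega)
  simp only [sub_add_cancel, add_sub_cancel_right] at p1 p2 q1 q2 r1 r2 s1 s2
  exact localUpdate_flip _ hU hD hL hR p1 p2 q1 q2 r1 r2 s1 s2

theorem shuffle_of_even {φ : ℤ × ℤ → ℤ} {b : ℤ × ℤ → Bool} {i j : ℤ} (h : Even (i + j)) :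
    shuffle φ b (i, j) = evenStep φ b (i, j) := oddStep_of_even h

/-- A shuffle preserves admissibility: each of its halves exchanges the parities. -/
theorem IsAdmissible.shuffle {φ : ℤ × ℤ → ℤ} (hφ : IsAdmissible φ) (b : ℤ × ℤ → Bool) :
    IsAdmissible (shuffle φ b) := by
  constructor
  · rw [shuffle_of_even (by simp), evenStep_of_even (by simp)]
    have h0 := hφ.1
    rcases localUpdate_eq_or (φ (0, 0)) (φ (0, 0 + 1)) (φ (0, 0 - 1)) (φ (0 - 1, 0))
      (φ (0 + 1, 0)) (b (0, 0)) with e | e <;> rw [e] <;> omega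
  · intro i j h
    have hf := hφ.isFlipped_evenStep b
    rw [shuffle_of_even h]
    have e1 := (hf.oddStep_neighbours b (i := i + 1) (j := j)
      (by rw [Int.even_iff] at h; rw [Int.odd_iff]; omega)).1.1
    have e2 := (hf.oddStep_neighbours b (i := i - 1) (j := j)
      (by rw [Int.even_iff] at h; rw [Int.odd_iff]; omega)).1.2
    have e3 := (hf.oddStep_neighbours b (i := i) (j := j + 1)
      (by rw [Int.even_iff] at h; rw [Int.odd_iff]; omega)).2.2
    have e4 := (hf.oddStep_neighbours b (i := i) (j := j - 1)
      (by rw [Int.even_iff] at h; rw [Int.odd_iff]; omega)).2.1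
    simp only [sub_add_cancel, add_sub_cancel_right] at e1 e2 e3 e4
    unfold DominoShuffling.shuffle
    omega

theorem evenStep_mono {φ ψ : ℤ × ℤ → ℤ} (hφ : IsAdmissible φ) (hψ : IsAdmissible ψ)
    (h : ∀ z, φ z ≤ ψ z) (b : ℤ × ℤ → Bool) (z : ℤ × ℤ) : evenStep φ b z ≤ evenStep ψ b z := by
  obtain ⟨i, j⟩ := z
  rcases Int.even_or_odd (i + j) with he | ho
  · rw [evenStep_of_even he, evenStep_of_even he]
    obtain ⟨-, -, hU, hD⟩ := hφ.2 i j he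
    obtain ⟨hR, hL, -, -⟩ := hψ.2 i j he
    exact localUpdate_mono _ (hψ.dvd_sub hφ _) hU hD hL hR (h _) (h _) (h _) (h _) (h _)
  · rw [evenStep_of_odd ho, evenStep_of_odd ho]
    exact h _

theorem shuffle_mono {φ ψ : ℤ × ℤ → ℤ} (hφ : IsAdmissible φ) (hψ : IsAdmissible ψ)
    (h : ∀ z, φ z ≤ ψ z) (b : ℤ × ℤ → Bool) (z : ℤ × ℤ) : shuffle φ b z ≤ shuffle ψ b z := by
  obtain ⟨i, j⟩ := z
  have he := evenStep_mono hφ hψ h b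
  rcases Int.even_or_odd (i + j) with hp | ho
  · rw [shuffle_of_even hp, shuffle_of_even hp]
    exact he _
  · unfold shuffle
    rw [oddStep_of_odd ho, oddStep_of_odd ho]
    obtain ⟨-, -, hU, hD⟩ := hφ.isFlipped_evenStep b i j ho
    obtain ⟨hR, hL, -, -⟩ := hψ.isFlipped_evenStep b i j ho
    refine localUpdate_mono _ ?_ hU hD hL hR (he _) ?_ ?_ ?_ ?_
    · rw [evenStep_of_odd ho, evenStep_of_odd ho]
      exact hψ.dvd_sub hφ _
    all_goals exact add_le_add_left (he _) _

theorem shuffle_add (φ : ℤ × ℤ → ℤ) (b : ℤ × ℤ → Bool) (m : ℤ) :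
    shuffle (fun z => φ z + m) b = fun z => shuffle φ b z + m := by
  have he : evenStep (fun z => φ z + m) b = fun z => evenStep φ b z + m := by
    funext z
    simp only [evenStep, localUpdate_add]
    split_ifs <;> rfl
  unfold shuffle
  rw [he]
  funext z
  simp only [oddStep, add_right_comm _ m 2, localUpdate_add]
  split_ifs <;> rfl

theorem shuffle_eq_or (φ : ℤ × ℤ → ℤ) (b : ℤ × ℤ → Bool) (z : ℤ × ℤ) :
    shuffle φ b z = φ z ∨ shuffle φ b z = φ z - 4 := by
  obtain ⟨i, j⟩ := z
  rcases Int.even_or_odd (i + j) with hp | ho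
  · rw [shuffle_of_even hp, evenStep_of_even hp]
    exact localUpdate_eq_or _ _ _ _ _ _
  · unfold shuffle
    rw [oddStep_of_odd ho, evenStep_of_odd ho]
    exact localUpdate_eq_or _ _ _ _ _ _

/-- The `ℓ¹` distance of two faces. -/
def latticeDist (w z : ℤ × ℤ) : ℤ := |w.1 - z.1| + |w.2 - z.2|

theorem evenStep_congr {φ ψ : ℤ × ℤ → ℤ} {b c : ℤ × ℤ → Bool} {z : ℤ × ℤ}
    (h : ∀ w, latticeDist w z ≤ 1 → φ w = ψ w ∧ b w = c w) : evenStep φ b z = evenStep ψ c z := by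
  have key : ∀ w, latticeDist w z ≤ 1 → φ w = ψ w := fun w hw => (h w hw).1
  unfold evenStep
  rw [key z (by simp [latticeDist]), key (z.1, z.2 + 1) (by simp [latticeDist]),
    key (z.1, z.2 - 1) (by simp [latticeDist]), key (z.1 - 1, z.2) (by simp [latticeDist]),
    key (z.1 + 1, z.2) (by simp [latticeDist]), (h z (by simp [latticeDist])).2]

/-- A shuffle has range of dependence `2` in the `ℓ¹` distance, as each half has range `1`. -/
theorem shuffle_congr {φ ψ : ℤ × ℤ → ℤ} {b c : ℤ × ℤ → Bool} {z : ℤ × ℤ}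
    (h : ∀ w, latticeDist w z ≤ 2 → φ w = ψ w ∧ b w = c w) : shuffle φ b z = shuffle ψ c z := by
  have tri : ∀ w v, latticeDist w v ≤ 1 → latticeDist v z ≤ 1 → latticeDist w z ≤ 2 := by
    intro w v h1 h2
    have e1 := abs_sub_le w.1 v.1 z.1
    have e2 := abs_sub_le w.2 v.2 z.2
    unfold latticeDist at *
    omega
  have key : ∀ v, latticeDist v z ≤ 1 → evenStep φ b v = evenStep ψ c v :=
    fun v hv => evenStep_congr fun w hw => h w (tri w v hw hv)
  unfold shuffle oddStep
  rw [key z (by simp [latticeDist]), key (z.1, z.2 + 1) (by simp [latticeDist]),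
    key (z.1, z.2 - 1) (by simp [latticeDist]), key (z.1 - 1, z.2) (by simp [latticeDist]),
    key (z.1 + 1, z.2) (by simp [latticeDist]), (h z (by simp [latticeDist])).2]

theorem IsAdmissible.height {φ : ℤ × ℤ → ℤ} (hφ : IsAdmissible φ) (ω : Marks) :
    ∀ t, IsAdmissible (height φ ω t)
  | 0 => hφ
  | t + 1 => (IsAdmissible.height hφ ω t).shuffle _

theorem height_mono {φ ψ : ℤ × ℤ → ℤ} (hφ : IsAdmissible φ) (hψ : IsAdmissible ψ)
    (h : ∀ z, φ z ≤ ψ z) (ω : Marks) : ∀ t z, height φ ω t z ≤ height ψ ω t z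
  | 0 => h
  | t + 1 => shuffle_mono (hφ.height ω t) (hψ.height ω t) (height_mono hφ hψ h ω t) _

theorem height_add (φ : ℤ × ℤ → ℤ) (ω : Marks) (m : ℤ) (t : ℕ) :
    height (fun z => φ z + m) ω t = fun z => height φ ω t z + m := by
  induction t with
  | zero => rfl
  | succ t ih => simp only [height, ih, shuffle_add]

theorem height_succ_bounds (φ : ℤ × ℤ → ℤ) (ω : Marks) (t : ℕ) (z : ℤ × ℤ) :
    height φ ω t z - 4 ≤ height φ ω (t + 1) z ∧ height φ ω (t + 1) z ≤ height φ ω t z := by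
  have := shuffle_eq_or (height φ ω t) (fun z => ω (z, t + 1)) z
  simp only [height]
  omega

theorem height_bounds (φ : ℤ × ℤ → ℤ) (ω : Marks) (t : ℕ) (z : ℤ × ℤ) :
    φ z - 4 * t ≤ height φ ω t z ∧ height φ ω t z ≤ φ z := by
  induction t with
  | zero => simp [height]
  | succ t ih =>
    have := height_succ_bounds φ ω t z
    push_cast
    omega

theorem timeShift_timeShift (s t : ℕ) (ω : Marks) :
    timeShift t (timeShift s ω) = timeShift (s + t) ω := by
  funext p
  simp only [timeShift]
  congr 2
  omega

/-- The cocycle property of the height process. -/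
theorem height_height (φ : ℤ × ℤ → ℤ) (ω : Marks) (s t : ℕ) :
    height (height φ ω s) (timeShift s ω) t = height φ ω (s + t) := by
  induction t with
  | zero => rfl
  | succ t ih =>
    rw [← add_assoc]
    simp only [height, ih, timeShift]
    congr 1
    funext z
    congr 2
    omega

/-- The height process has range of dependence `2t`, in the initial height function and in the
marks. -/
theorem height_congr {φ ψ : ℤ × ℤ → ℤ} {ω ω' : Marks} {t : ℕ} {z : ℤ × ℤ}
    (h : ∀ w, latticeDist w z ≤ 2 * t → φ w = ψ w ∧ ∀ s, 0 < s → s ≤ t → ω (w, s) = ω' (w, s)) :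
    height φ ω t z = height ψ ω' t z := by
  induction t generalizing z with
  | zero => exact (h z (by simp [latticeDist])).1
  | succ t ih =>
    refine shuffle_congr fun v hv => ⟨ih fun w hw => ?_, ?_⟩
    · have e1 := abs_sub_le w.1 v.1 z.1
      have e2 := abs_sub_le w.2 v.2 z.2
      have := h w (by unfold latticeDist at *; push_cast; omega)
      exact ⟨this.1, fun s hs hst => this.2 s hs (by omega)⟩
    · exact (h v (by push_cast; omega)).2 (t + 1) (by omega) le_rfl

/-! ### The pyramid and the initial height functions -/

/-- A closed formula for the pyramid height function. -/
def pyramidFormula (z : ℤ × ℤ) : ℤ :=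
  -2 * max |z.1| |z.2| + if Even (z.1 + z.2) then 0 else if |z.2| < |z.1| then 1 else -1

theorem pyramidFormula_neg (z : ℤ × ℤ) : pyramidFormula (-z) = pyramidFormula z := by
  have : Even (-z.1 + -z.2) ↔ Even (z.1 + z.2) := by rw [← neg_add, even_neg]
  simp only [pyramidFormula, Prod.fst_neg, Prod.snd_neg, abs_neg, this]

theorem pyramidFormula_of_even {z : ℤ × ℤ} (h : Even (z.1 + z.2)) :
    pyramidFormula z = -2 * max |z.1| |z.2| := by
  rw [pyramidFormula, if_pos h, add_zero]

theorem isAdmissible_pyramidFormula : IsAdmissible pyramidFormula := by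
  refine ⟨by simp [pyramidFormula], fun i j h => ?_⟩
  have o1 : ¬Even (i + 1 + j) := by rw [Int.even_iff] at *; omega
  have o2 : ¬Even (i - 1 + j) := by rw [Int.even_iff] at *; omega
  have o3 : ¬Even (i + (j + 1)) := by rw [Int.even_iff] at *; omega
  have o4 : ¬Even (i + (j - 1)) := by rw [Int.even_iff] at *; omega
  simp only [pyramidFormula, h, o1, o2, o3, o4, if_true, if_false]
  rw [Int.even_iff] at h
  clear o1 o2 o3 o4
  simp only [abs_eq_max_neg]
  refine ⟨?_, ?_, ?_, ?_⟩ <;> split_ifs <;> omega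

theorem IsAdmissible.diagonal {φ : ℤ × ℤ → ℤ} (hφ : IsAdmissible φ) {i j : ℤ} (h : Even (i + j)) :
    φ (i, j) - 2 ≤ φ (i + 1, j + 1) ∧ φ (i, j) - 2 ≤ φ (i + 1, j - 1) ∧
      φ (i, j) - 2 ≤ φ (i - 1, j + 1) ∧ φ (i, j) - 2 ≤ φ (i - 1, j - 1) := by
  obtain ⟨hR, hL, hU, hD⟩ := hφ.2 i j h
  obtain ⟨-, p1, -, -⟩ := hφ.2 (i + 1) (j + 1) (by rw [Int.even_iff] at *; omega)
  obtain ⟨-, q1, -, -⟩ := hφ.2 (i + 1) (j - 1) (by rw [Int.even_iff] at *; omega)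
  obtain ⟨r1, -, -, -⟩ := hφ.2 (i - 1) (j + 1) (by rw [Int.even_iff] at *; omega)
  obtain ⟨s1, -, -, -⟩ := hφ.2 (i - 1) (j - 1) (by rw [Int.even_iff] at *; omega)
  obtain ⟨-, -, -, p2⟩ := hφ.2 (i + 1) (j + 1) (by rw [Int.even_iff] at *; omega)
  obtain ⟨-, -, q2, -⟩ := hφ.2 (i + 1) (j - 1) (by rw [Int.even_iff] at *; omega)
  obtain ⟨-, -, -, r2⟩ := hφ.2 (i - 1) (j + 1) (by rw [Int.even_iff] at *; omega)
  obtain ⟨-, -, s2, -⟩ := hφ.2 (i - 1) (j - 1) (by rw [Int.even_iff] at *; omega)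
  simp only [sub_add_cancel, add_sub_cancel_right] at p1 p2 q1 q2 r1 r2 s1 s2
  refine ⟨?_, ?_, ?_, ?_⟩ <;> omega

/-- At even faces the height drops by at most `2` per diagonal step. -/
theorem IsAdmissible.le_of_even {φ : ℤ × ℤ → ℤ} (hφ : IsAdmissible φ) (h0 : φ (0, 0) = 0) (M : ℕ) :
    ∀ i j : ℤ, Even (i + j) → max |i| |j| ≤ M → -2 * (M : ℤ) ≤ φ (i, j) := by
  induction M with
  | zero =>
    intro i j _ hM
    have hi : i = 0 := abs_nonpos_iff.1 ((le_max_left |i| |j|).trans hM)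
    have hj : j = 0 := abs_nonpos_iff.1 ((le_max_right |i| |j|).trans hM)
    rw [hi, hj, h0]
    simp
  | succ M ih =>
    intro i j he hM
    by_cases hlt : max |i| |j| ≤ M
    · have := ih i j he hlt
      push_cast
      omega
    have step : ∀ s t : ℤ, (s = 1 ∨ s = -1) → (t = 1 ∨ t = -1) → max |i - s| |j - t| ≤ (M : ℤ) →
        -2 * ((M + 1 : ℕ) : ℤ) ≤ φ (i, j) := by
      intro s t hs ht hst
      have he' : Even (i - s + (j - t)) := by rw [Int.even_iff] at *; omega
      have h1 := ih _ _ he' hst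
      have h2 := hφ.diagonal he'
      push_cast
      rcases hs with rfl | rfl <;> rcases ht with rfl | rfl <;>
        simp only [sub_add_cancel, sub_neg_eq_add, add_sub_cancel_right] at h1 h2 <;> omega
    refine step (if 0 < i then 1 else -1) (if 0 < j then 1 else -1) (by split_ifs <;> simp)
      (by split_ifs <;> simp) ?_
    simp only [abs_eq_max_neg] at *
    rw [Int.even_iff] at he
    push_cast at *
    split_ifs <;> omega

theorem IsAdmissible.pyramidFormula_le {φ : ℤ × ℤ → ℤ} (hφ : IsAdmissible φ) (h0 : φ (0, 0) = 0)
    (z : ℤ × ℤ) : pyramidFormula z ≤ φ z := by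
  obtain ⟨i, j⟩ := z
  have key : ∀ i j : ℤ, Even (i + j) → -2 * max |i| |j| ≤ φ (i, j) := by
    intro i j he
    have := hφ.le_of_even h0 (max |i| |j|).toNat i j he (Int.self_le_toNat _)
    have hn : 0 ≤ max |i| |j| := (abs_nonneg i).trans (le_max_left _ _)
    rwa [Int.toNat_of_nonneg hn] at this
  by_cases he : Even (i + j)
  · rw [pyramidFormula_of_even he]
    exact key i j he
  -- an odd face is compared with its neighbour nearer to the origin
  have e1 : Even (i - 1 + j) := by rw [Int.even_iff] at *; omega
  have e2 : Even (i + 1 + j) := by rw [Int.even_iff] at *; omega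
  have e3 : Even (i + (j - 1)) := by rw [Int.even_iff] at *; omega
  have e4 : Even (i + (j + 1)) := by rw [Int.even_iff] at *; omega
  have k1 := key _ _ e1
  have k2 := key _ _ e2
  have k3 := key _ _ e3
  have k4 := key _ _ e4
  have a1 := (hφ.2 _ _ e1).1
  have a2 := (hφ.2 _ _ e2).2.1
  have a3 := (hφ.2 _ _ e3).2.2.1
  have a4 := (hφ.2 _ _ e4).2.2.2
  simp only [sub_add_cancel, add_sub_cancel_right] at a1 a2 a3 a4
  simp only [pyramidFormula, he, if_false]
  rw [Int.even_iff] at he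
  clear e1 e2 e3 e4 key
  simp only [abs_eq_max_neg] at *
  split_ifs <;> omega

theorem pyramid_eq : pyramid = pyramidFormula := by
  funext z
  refine IsLeast.csInf_eq ⟨⟨pyramidFormula, isAdmissible_pyramidFormula, by simp [pyramidFormula],
    rfl⟩, ?_⟩
  rintro _ ⟨φ, hφ, h0, rfl⟩
  exact hφ.pyramidFormula_le h0 z

/-- The Lipschitz condition of asymptotic height functions. -/
def IsLip (g : ℝ × ℝ → ℝ) : Prop :=
  ∀ x y : ℝ × ℝ, |g x - g y| ≤ 2 * max |x.1 - y.1| |x.2 - y.2|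

theorem IsLip.scaled {g : ℝ × ℝ → ℝ} (hg : IsLip g) {n : ℕ} (hn : 0 < n) (a b c d : ℝ) :
    |n * g (a / n, b / n) - n * g (c / n, d / n)| ≤ 2 * max |a - c| |b - d| := by
  have hn' : (0 : ℝ) < n := Nat.cast_pos.2 hn
  have := hg (a / n, b / n) (c / n, d / n)
  simp only [← sub_div, abs_div, abs_of_pos hn', max_div_div_right hn'.le] at this
  rw [← mul_sub, abs_mul, abs_of_pos hn']
  calc (n : ℝ) * _ ≤ n * (2 * (max |a - c| |b - d| / n)) := by gcongr
    _ = _ := by field_simp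

/-- The largest integer below `n g(z / n)` in the residue class modulo `4` of the heights
at `z`. -/
def roundDown (n : ℕ) (g : ℝ × ℝ → ℝ) (z : ℤ × ℤ) : ℤ :=
  pyramidFormula z + 4 * ⌊(n * g ((z.1 : ℝ) / n, (z.2 : ℝ) / n) - pyramidFormula z) / 4⌋

theorem roundDown_le (n : ℕ) (g : ℝ × ℝ → ℝ) (z : ℤ × ℤ) :
    (roundDown n g z : ℝ) ≤ n * g ((z.1 : ℝ) / n, (z.2 : ℝ) / n) := by
  have := Int.floor_le ((n * g ((z.1 : ℝ) / n, (z.2 : ℝ) / n) - pyramidFormula z) / 4)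
  unfold roundDown
  push_cast
  linarith

theorem lt_roundDown_add (n : ℕ) (g : ℝ × ℝ → ℝ) (z : ℤ × ℤ) :
    n * g ((z.1 : ℝ) / n, (z.2 : ℝ) / n) < roundDown n g z + 4 := by
  have := Int.lt_floor_add_one ((n * g ((z.1 : ℝ) / n, (z.2 : ℝ) / n) - pyramidFormula z) / 4)
  unfold roundDown
  push_cast
  linarith

theorem le_roundDown {n : ℕ} {g : ℝ × ℝ → ℝ} {z : ℤ × ℤ} {m : ℤ} (hm : 4 ∣ m - pyramidFormula z)
    (h : (m : ℝ) ≤ n * g ((z.1 : ℝ) / n, (z.2 : ℝ) / n)) : m ≤ roundDown n g z := by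
  obtain ⟨k, hk⟩ := hm
  have hk' : (m : ℝ) - pyramidFormula z = 4 * k := by exact_mod_cast hk
  have : k ≤ ⌊(n * g ((z.1 : ℝ) / n, (z.2 : ℝ) / n) - pyramidFormula z) / 4⌋ := by
    rw [Int.le_floor]
    linarith
  unfold roundDown
  omega

theorem dvd_roundDown_sub (n : ℕ) (g : ℝ × ℝ → ℝ) (z : ℤ × ℤ) :
    4 ∣ roundDown n g z - pyramidFormula z := by
  unfold roundDown
  omega

theorem isAdmissible_translate {y : ℤ × ℤ} (hy : Even (y.1 + y.2)) {k : ℤ}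
    (hk : 4 ∣ k - pyramidFormula y) : IsAdmissible fun z => pyramidFormula (z - y) + k := by
  refine ⟨?_, fun i j h => ?_⟩
  · have e : ((0 : ℤ), (0 : ℤ)) - y = -y := by ext <;> simp
    have hc : pyramidFormula y = -2 * max |y.1| |y.2| := pyramidFormula_of_even hy
    simp only [e, pyramidFormula_neg]
    omega
  · have := isAdmissible_pyramidFormula.2 (i - y.1) (j - y.2) (by rw [Int.even_iff] at *; omega)
    obtain ⟨a, b⟩ := y
    simp only [Prod.mk_sub_mk, sub_right_comm _ _ (1 : ℤ), add_sub_right_comm _ (1 : ℤ)] at *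
    omega

/-- The translate of the pyramid to an even face, at the largest height that is allowed. -/
theorem cone_mem_belowProfile (n : ℕ) (g : ℝ × ℝ → ℝ) {y : ℤ × ℤ} (hy : Even (y.1 + y.2)) :
    (fun z => pyramid (z - y) + roundDown n g y) ∈ belowProfile n g := by
  refine ⟨?_, y, _, rfl, roundDown_le n g y⟩
  rw [pyramid_eq]
  exact isAdmissible_translate hy (dvd_roundDown_sub n g y)

theorem le_cone_of_mem_belowProfile {n : ℕ} {g : ℝ × ℝ → ℝ} {φ : ℤ × ℤ → ℤ}
    (h : φ ∈ belowProfile n g) :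
    ∃ y : ℤ × ℤ, Even (y.1 + y.2) ∧ ∀ z, φ z ≤ pyramidFormula (z - y) + roundDown n g y := by
  obtain ⟨hφ, ⟨a, b⟩, k, rfl, hk⟩ := h
  rw [pyramid_eq] at *
  have hy : Even (a + b) := by
    by_contra ho
    -- at an odd apex the horizontal steps of the pyramid have the wrong sign
    have := (hφ.2 (a + 1) b (by rw [Int.even_iff] at *; omega)).2.1
    simp [pyramidFormula] at this
    omega
  refine ⟨(a, b), hy, fun z => ?_⟩
  have hd := hφ.dvd_sub isAdmissible_pyramidFormula (a, b)
  have h0 : pyramidFormula ((a, b) - (a, b)) = 0 := by simp [pyramidFormula]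
  simp only [h0, zero_add] at hd
  have := le_roundDown hd hk
  simp only
  omega

theorem cone_le_roundDown {n : ℕ} (hn : 0 < n) {g : ℝ × ℝ → ℝ} (hg : IsLip g) {y z : ℤ × ℤ}
    (hy : Even (y.1 + y.2)) (hz : Even (z.1 + z.2)) :
    pyramidFormula (z - y) + roundDown n g y ≤ roundDown n g z := by
  have hadm := isAdmissible_translate hy (dvd_roundDown_sub n g y)
  refine le_roundDown (hadm.dvd_sub isAdmissible_pyramidFormula z) ?_
  rw [pyramidFormula_of_even (by simp only [Prod.fst_sub, Prod.snd_sub]; rw [Int.even_iff] at *; omega)]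
  have h1 := roundDown_le n g y
  have h2 := (abs_le.1 (hg.scaled hn z.1 z.2 y.1 y.2)).1
  push_cast [Prod.fst_sub, Prod.snd_sub]
  linarith

/-- The pyramid at an odd face is reached through the neighbouring even face that is nearer to
the apex. -/
theorem cone_le_of_neighbours {u v k₀ k₁ k₂ k₃ k₄ : ℤ} (h : ¬Even (u + v))
    (c₁ : -2 * max |u - 1| |v| + k₀ ≤ k₁) (c₂ : -2 * max |u + 1| |v| + k₀ ≤ k₂)
    (c₃ : -2 * max |u| |v - 1| + k₀ ≤ k₃) (c₄ : -2 * max |u| |v + 1| + k₀ ≤ k₄) :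
    (-2 * max |u| |v| + if |v| < |u| then 1 else -1) + k₀ ≤
      max (max (k₂ - 1) (k₁ - 1)) (max (k₄ - 3) (k₃ - 3)) := by
  rw [Int.even_iff] at h
  simp only [abs_eq_max_neg] at *
  split_ifs with hc
  · refine le_trans ?_ (le_max_left _ _)
    rcases le_or_gt u 0 with hu | hu
    · refine le_trans ?_ (le_max_left _ _)
      clear c₁ c₃ c₄
      omega
    · refine le_trans ?_ (le_max_right _ _)
      clear c₂ c₃ c₄
      omega
  · refine le_trans ?_ (le_max_right _ _)
    rcases le_or_gt v 0 with hv | hv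
    · refine le_trans ?_ (le_max_left _ _)
      clear c₁ c₂ c₃
      omega
    · refine le_trans ?_ (le_max_right _ _)
      clear c₁ c₂ c₄
      omega

/-- A closed formula for the initial height function: at even faces it is the profile rounded
down, at odd faces the least value allowed by the neighbouring even faces. -/
def initialFormula (n : ℕ) (g : ℝ × ℝ → ℝ) (z : ℤ × ℤ) : ℤ :=
  if Even (z.1 + z.2) then roundDown n g z
  else max (max (roundDown n g (z.1 + 1, z.2) - 1) (roundDown n g (z.1 - 1, z.2) - 1))
    (max (roundDown n g (z.1, z.2 + 1) - 3) (roundDown n g (z.1, z.2 - 1) - 3))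

theorem isGreatest_initialFormula {n : ℕ} (hn : 0 < n) {g : ℝ × ℝ → ℝ} (hg : IsLip g) (z : ℤ × ℤ) :
    IsGreatest {m : ℤ | ∃ φ ∈ belowProfile n g, φ z = m} (initialFormula n g z) := by
  obtain ⟨i, j⟩ := z
  constructor
  · by_cases he : Even (i + j)
    · refine ⟨_, cone_mem_belowProfile n g (y := (i, j)) he, ?_⟩
      simp [pyramid_eq, pyramidFormula, initialFormula, he]
    · have e1 : Even (i - 1 + j) := by rw [Int.even_iff] at *; omega
      have e2 : Even (i + 1 + j) := by rw [Int.even_iff] at *; omega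
      have e3 : Even (i + (j - 1)) := by rw [Int.even_iff] at *; omega
      have e4 : Even (i + (j + 1)) := by rw [Int.even_iff] at *; omega
      simp only [initialFormula, he, if_false]
      rcases max_choice (max (roundDown n g (i + 1, j) - 1) (roundDown n g (i - 1, j) - 1))
        (max (roundDown n g (i, j + 1) - 3) (roundDown n g (i, j - 1) - 3)) with h | h <;> rw [h]
      · rcases max_choice (roundDown n g (i + 1, j) - 1) (roundDown n g (i - 1, j) - 1)
          with h | h <;> rw [h]
        · refine ⟨_, cone_mem_belowProfile n g (y := (i + 1, j)) e2, ?_⟩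
          simp [pyramid_eq, pyramidFormula]
          ring
        · refine ⟨_, cone_mem_belowProfile n g (y := (i - 1, j)) e1, ?_⟩
          simp [pyramid_eq, pyramidFormula]
          ring
      · rcases max_choice (roundDown n g (i, j + 1) - 3) (roundDown n g (i, j - 1) - 3)
          with h | h <;> rw [h]
        · refine ⟨_, cone_mem_belowProfile n g (y := (i, j + 1)) e4, ?_⟩
          simp [pyramid_eq, pyramidFormula]
          ring
        · refine ⟨_, cone_mem_belowProfile n g (y := (i, j - 1)) e3, ?_⟩
          simp [pyramid_eq, pyramidFormula]
          ring
  · rintro _ ⟨φ, hφ, rfl⟩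
    obtain ⟨⟨a, b⟩, hy, hle⟩ := le_cone_of_mem_belowProfile hφ
    refine (hle (i, j)).trans ?_
    by_cases he : Even (i + j)
    · simp only [initialFormula, he, if_true]
      exact cone_le_roundDown hn hg hy he
    · have e1 : Even (i - 1 + j) := by rw [Int.even_iff] at *; omega
      have e2 : Even (i + 1 + j) := by rw [Int.even_iff] at *; omega
      have e3 : Even (i + (j - 1)) := by rw [Int.even_iff] at *; omega
      have e4 : Even (i + (j + 1)) := by rw [Int.even_iff] at *; omega
      have c1 := cone_le_roundDown hn hg hy (z := (i - 1, j)) e1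
      have c2 := cone_le_roundDown hn hg hy (z := (i + 1, j)) e2
      have c3 := cone_le_roundDown hn hg hy (z := (i, j - 1)) e3
      have c4 := cone_le_roundDown hn hg hy (z := (i, j + 1)) e4
      simp only [initialFormula, he, if_false]
      rw [Int.even_iff] at he
      simp only at hy
      rw [pyramidFormula_of_even (by simp only [Prod.mk_sub_mk]; rw [Int.even_iff] at *; omega)]
        at c1 c2 c3 c4
      have ho : ¬Even (i - a + (j - b)) := by rw [Int.even_iff] at *; omega
      simp only [pyramidFormula, Prod.mk_sub_mk, ho, if_false] at c1 c2 c3 c4 ⊢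
      rw [show i - 1 - a = i - a - 1 by ring] at c1
      rw [show i + 1 - a = i - a + 1 by ring] at c2
      rw [show j - 1 - b = j - b - 1 by ring] at c3
      rw [show j + 1 - b = j - b + 1 by ring] at c4
      exact cone_le_of_neighbours ho c1 c2 c3 c4

theorem initialHeight_eq {n : ℕ} (hn : 0 < n) {g : ℝ × ℝ → ℝ} (hg : IsLip g) :
    initialHeight n g = initialFormula n g :=
  funext fun z => (isGreatest_initialFormula hn hg z).csSup_eq

/-- The pointwise maximum of admissible height functions is admissible, since their values at a
face are in the same residue class modulo `4`. -/
theorem isAdmissible_initialHeight {n : ℕ} (hn : 0 < n) {g : ℝ × ℝ → ℝ} (hg : IsLip g) :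
    IsAdmissible (initialHeight n g) := by
  rw [initialHeight_eq hn hg]
  have att : ∀ z, ∃ φ, IsAdmissible φ ∧ φ z = initialFormula n g z ∧
      ∀ w, φ w ≤ initialFormula n g w := by
    intro z
    obtain ⟨φ, hφ, hz⟩ := (isGreatest_initialFormula hn hg z).1
    exact ⟨φ, hφ.1, hz, fun w => (isGreatest_initialFormula hn hg w).2 ⟨φ, hφ, rfl⟩⟩
  refine ⟨?_, fun i j h => ?_⟩
  · obtain ⟨φ, hφ, hz, -⟩ := att (0, 0)
    rw [← hz]
    exact hφ.1
  · obtain ⟨φ, hφ, hz, hle⟩ := att (i, j)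
    have hc := hφ.2 i j h
    refine ⟨?_, ?_, ?_, ?_⟩
    · obtain ⟨ψ, hψ, hw, hle'⟩ := att (i + 1, j)
      have h1 := (hψ.2 i j h).1
      have h2 := hφ.dvd_sub hψ (i, j)
      have h3 := hle (i + 1, j)
      have h4 := hle' (i, j)
      omega
    · obtain ⟨ψ, hψ, hw, hle'⟩ := att (i - 1, j)
      have h1 := (hψ.2 i j h).2.1
      have h2 := hφ.dvd_sub hψ (i, j)
      have h3 := hle (i - 1, j)
      have h4 := hle' (i, j)
      omega
    · obtain ⟨ψ, hψ, hw, hle'⟩ := att (i, j + 1)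
      have h1 := (hψ.2 i j h).2.2.1
      have h2 := hφ.dvd_sub hψ (i, j)
      have h3 := hle (i, j + 1)
      have h4 := hle' (i, j)
      omega
    · obtain ⟨ψ, hψ, hw, hle'⟩ := att (i, j - 1)
      have h1 := (hψ.2 i j h).2.2.2
      have h2 := hφ.dvd_sub hψ (i, j)
      have h3 := hle (i, j - 1)
      have h4 := hle' (i, j)
      omega

theorem initialHeight_of_even {n : ℕ} (hn : 0 < n) {g : ℝ × ℝ → ℝ} (hg : IsLip g) {z : ℤ × ℤ}
    (hz : Even (z.1 + z.2)) : initialHeight n g z = roundDown n g z := by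
  rw [initialHeight_eq hn hg]
  exact if_pos hz

theorem abs_initialHeight_sub_le {n : ℕ} (hn : 0 < n) {g : ℝ × ℝ → ℝ} (hg : IsLip g) (z : ℤ × ℤ) :
    |(initialHeight n g z : ℝ) - n * g ((z.1 : ℝ) / n, (z.2 : ℝ) / n)| ≤ 7 := by
  by_cases he : Even (z.1 + z.2)
  · rw [initialHeight_of_even hn hg he, abs_le]
    have h1 := roundDown_le n g z
    have h2 := lt_roundDown_add n g z
    constructor <;> linarith
  · obtain ⟨i, j⟩ := z
    have near : ∀ w : ℤ × ℤ, |(w.1 : ℝ) - i| ≤ 1 → |(w.2 : ℝ) - j| ≤ 1 →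
        n * g ((i : ℝ) / n, (j : ℝ) / n) - 6 ≤ roundDown n g w ∧
        roundDown n g w ≤ n * g ((i : ℝ) / n, (j : ℝ) / n) + 2 := by
      intro w h1 h2
      have h := (hg.scaled hn w.1 w.2 i j).trans
        (mul_le_mul_of_nonneg_left (max_le h1 h2) zero_le_two)
      have h3 := roundDown_le n g w
      have h4 := lt_roundDown_add n g w
      rw [abs_le] at h
      constructor <;> linarith
    have n1 := near (i + 1, j) (by simp) (by simp)
    have n2 := near (i - 1, j) (by simp) (by simp)
    have n3 := near (i, j + 1) (by simp) (by simp)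
    have n4 := near (i, j - 1) (by simp) (by simp)
    simp only [initialHeight_eq hn hg, initialFormula, he, if_false]
    push_cast
    rw [abs_le]
    constructor
    · have h5 : n * g ((i : ℝ) / n, (j : ℝ) / n) - 7 ≤ roundDown n g (i + 1, j) - 1 := by
        linarith
      have := h5.trans ((le_max_left _ ((roundDown n g (i - 1, j) : ℝ) - 1)).trans
        (le_max_left _ (max ((roundDown n g (i, j + 1) : ℝ) - 3) (roundDown n g (i, j - 1) - 3))))
      linarith
    · rw [sub_le_iff_le_add]
      refine max_le (max_le ?_ ?_) (max_le ?_ ?_) <;> linarith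

theorem initialHeight_congr {n : ℕ} (hn : 0 < n) {g₁ g₂ : ℝ × ℝ → ℝ} (h₁ : IsLip g₁)
    (h₂ : IsLip g₂) {z : ℤ × ℤ}
    (h : ∀ w : ℤ × ℤ, latticeDist w z ≤ 1 →
      g₁ ((w.1 : ℝ) / n, (w.2 : ℝ) / n) = g₂ ((w.1 : ℝ) / n, (w.2 : ℝ) / n)) :
    initialHeight n g₁ z = initialHeight n g₂ z := by
  have key : ∀ w : ℤ × ℤ, latticeDist w z ≤ 1 → roundDown n g₁ w = roundDown n g₂ w :=
    fun w hw => by unfold roundDown; rw [h w hw]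
  simp only [initialHeight_eq hn h₁, initialHeight_eq hn h₂, initialFormula]
  rw [key z (by simp [latticeDist]), key (z.1, z.2 + 1) (by simp [latticeDist]),
    key (z.1, z.2 - 1) (by simp [latticeDist]), key (z.1 - 1, z.2) (by simp [latticeDist]),
    key (z.1 + 1, z.2) (by simp [latticeDist])]

theorem initialHeight_mono {n : ℕ} (hn : 0 < n) {g₁ g₂ : ℝ × ℝ → ℝ} (h₁ : IsLip g₁)
    (h₂ : IsLip g₂) (h : ∀ x, g₁ x ≤ g₂ x) (z : ℤ × ℤ) :
    initialHeight n g₁ z ≤ initialHeight n g₂ z := by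
  obtain ⟨φ, ⟨hφ, y, k, rfl, hk⟩, hz⟩ := (isGreatest_initialFormula hn h₁ z).1
  rw [initialHeight_eq hn h₁, initialHeight_eq hn h₂]
  refine (isGreatest_initialFormula hn h₂ z).2 ⟨_, ⟨hφ, y, k, rfl, hk.trans ?_⟩, hz⟩
  exact mul_le_mul_of_nonneg_left (h _) n.cast_nonneg

theorem IsLip.add_const {g : ℝ × ℝ → ℝ} (hg : IsLip g) (m : ℝ) : IsLip fun x => g x + m := by
  intro x y
  rw [add_sub_add_right_eq_sub]
  exact hg x y

/-- Raising the profile by `4 m / n` raises the initial height function by `4 m`. -/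
theorem initialHeight_add {n : ℕ} (hn : 0 < n) {g : ℝ × ℝ → ℝ} (hg : IsLip g) (m : ℤ) :
    initialHeight n (fun x => g x + 4 * m / n) = fun z => initialHeight n g z + 4 * m := by
  have hn' : (n : ℝ) ≠ 0 := Nat.cast_ne_zero.2 hn.ne'
  have key : ∀ w, roundDown n (fun x => g x + 4 * m / n) w = roundDown n g w + 4 * m := by
    intro w
    unfold roundDown
    have : ((n : ℝ) * (g ((w.1 : ℝ) / n, (w.2 : ℝ) / n) + 4 * m / n) - pyramidFormula w) / 4 =
        (n * g ((w.1 : ℝ) / n, (w.2 : ℝ) / n) - pyramidFormula w) / 4 + (m : ℤ) := by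
      field_simp
      ring
    rw [this, Int.floor_add_intCast]
    ring
  rw [initialHeight_eq hn hg, initialHeight_eq hn (hg.add_const _)]
  funext z
  simp only [initialFormula, key]
  split_ifs <;> omega

/-! ### Interpolation -/

theorem squareInterp_const (c x y : ℝ) : squareInterp c c c c x y = c := by
  unfold squareInterp
  simp only [max_self, min_self]
  split_ifs <;> ring

theorem squareInterp_add (f00 f20 f22 f02 x y m : ℝ) :
    squareInterp (f00 + m) (f20 + m) (f22 + m) (f02 + m) x y =
      squareInterp f00 f20 f22 f02 x y + m := by
  unfold squareInterp
  simp only [max_add_add_right, min_add_add_right]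
  split_ifs <;> ring

/-- In the square the interpolation is a combination with nonnegative coefficients of the value
at the centre and of the corner values. -/
theorem squareInterp_mono {f00 f20 f22 f02 g00 g20 g22 g02 x y : ℝ} (h00 : f00 ≤ g00)
    (h20 : f20 ≤ g20) (h22 : f22 ≤ g22) (h02 : f02 ≤ g02) (hx0 : 0 ≤ x) (hx2 : x ≤ 2)
    (hy0 : 0 ≤ y) (hy2 : y ≤ 2) :
    squareInterp f00 f20 f22 f02 x y ≤ squareInterp g00 g20 g22 g02 x y := by
  have hc : (max (max f00 f20) (max f22 f02) + min (min f00 f20) (min f22 f02)) / 2 ≤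
      (max (max g00 g20) (max g22 g02) + min (min g00 g20) (min g22 g02)) / 2 := by
    gcongr
  unfold squareInterp
  generalize (max (max f00 f20) (max f22 f02) + min (min f00 f20) (min f22 f02)) / 2 = c at *
  generalize (max (max g00 g20) (max g22 g02) + min (min g00 g20) (min g22 g02)) / 2 = d at *
  simp only
  split_ifs with h1 h2 h2
  · nlinarith [mul_nonneg (sub_nonneg.2 h00) (by linarith : 0 ≤ 2 - x - y),
      mul_nonneg (sub_nonneg.2 h20) (by linarith : 0 ≤ x - y), mul_nonneg (sub_nonneg.2 hc) hy0]
  · nlinarith [mul_nonneg (sub_nonneg.2 h20) (by linarith : 0 ≤ x - y),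
      mul_nonneg (sub_nonneg.2 h22) (by linarith : 0 ≤ x + y - 2),
      mul_nonneg (sub_nonneg.2 hc) (by linarith : 0 ≤ 2 - x)]
  · nlinarith [mul_nonneg (sub_nonneg.2 h00) (by linarith : 0 ≤ 2 - x - y),
      mul_nonneg (sub_nonneg.2 h02) (by linarith : 0 ≤ y - x), mul_nonneg (sub_nonneg.2 hc) hx0]
  · nlinarith [mul_nonneg (sub_nonneg.2 h02) (by linarith : 0 ≤ y - x),
      mul_nonneg (sub_nonneg.2 h22) (by linarith : 0 ≤ x + y - 2),
      mul_nonneg (sub_nonneg.2 hc) (by linarith : 0 ≤ 2 - y)]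

theorem squareInterp_left (f00 f20 f22 f02 : ℝ) {y : ℝ} (h0 : 0 ≤ y) (h2 : y ≤ 2) :
    squareInterp f00 f20 f22 f02 0 y = f00 + (f02 - f00) / 2 * y := by
  unfold squareInterp
  simp only [sub_zero, if_pos h2]
  split_ifs with h
  · rw [le_antisymm h h0]; ring
  · ring

theorem squareInterp_right (f00 f20 f22 f02 : ℝ) {y : ℝ} (h0 : 0 ≤ y) (h2 : y ≤ 2) :
    squareInterp f00 f20 f22 f02 2 y = f20 + (f22 - f20) / 2 * y := by
  unfold squareInterp
  simp only [sub_self, if_pos h2]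
  split_ifs with h
  · rw [le_antisymm h h0]; ring
  · ring

theorem squareInterp_bottom (f00 f20 f22 f02 : ℝ) {x : ℝ} (h0 : 0 ≤ x) (h2 : x ≤ 2) :
    squareInterp f00 f20 f22 f02 x 0 = f00 + (f20 - f00) / 2 * x := by
  unfold squareInterp
  simp only [if_pos h0, if_pos (sub_nonneg.2 h2)]
  ring

theorem squareInterp_top (f00 f20 f22 f02 : ℝ) {x : ℝ} (h0 : 0 ≤ x) (h2 : x ≤ 2) :
    squareInterp f00 f20 f22 f02 x 2 = f02 + (f22 - f02) / 2 * x := by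
  unfold squareInterp
  simp only [le_sub_self_iff]
  split_ifs with h h' h'
  · linarith
  · rw [le_antisymm h2 h]; ring
  · rw [le_antisymm h' h0]; ring
  · ring

/-- If each corner value is `m - 2` or `m + 2`, as for height functions, then on each triangle
the gradient is `0`, `(± 2, 0)` or `(0, ± 2)`. -/
theorem squareInterp_lip {f00 f20 f22 f02 m : ℝ} (h00 : f00 = m - 2 ∨ f00 = m + 2)
    (h20 : f20 = m - 2 ∨ f20 = m + 2) (h22 : f22 = m - 2 ∨ f22 = m + 2)
    (h02 : f02 = m - 2 ∨ f02 = m + 2) (x y x' y' : ℝ) :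
    |squareInterp f00 f20 f22 f02 x y - squareInterp f00 f20 f22 f02 x' y'| ≤
      2 * max |x - x'| |y - y'| := by
  obtain ⟨d, hd⟩ : ∃ d, d = max |x - x'| |y - y'| := ⟨_, rfl⟩
  have h1 := abs_le.1 ((le_max_left |x - x'| |y - y'|).trans hd.ge)
  have h2 := abs_le.1 ((le_max_right |x - x'| |y - y'|).trans hd.ge)
  have hadd := fun f00 f20 f22 f02 x y => squareInterp_add f00 f20 f22 f02 x y m
  rw [← hd]
  clear hd
  obtain ⟨h1a, h1b⟩ := h1
  obtain ⟨h2a, h2b⟩ := h2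
  rcases h00 with rfl | rfl <;> rcases h20 with rfl | rfl <;> rcases h22 with rfl | rfl <;>
    rcases h02 with rfl | rfl <;>
    simp only [sub_eq_neg_add m 2, add_comm m 2, hadd, add_sub_add_right_eq_sub] <;>
    clear hadd <;> norm_num [squareInterp] <;> try linarith
  all_goals
    (split_ifs <;> rw [abs_le] <;> constructor <;> linarith)

/-- The interpolation as a function on a closed square of the lattice `2ℤ²`. -/
theorem interp_eq (φ : ℤ × ℤ → ℤ) {x : ℝ × ℝ} {i j : ℤ} (hi : 2 * i ≤ x.1) (hi' : x.1 ≤ 2 * i + 2)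
    (hj : 2 * j ≤ x.2) (hj' : x.2 ≤ 2 * j + 2) :
    interp φ x = squareInterp (φ (2 * i, 2 * j)) (φ (2 * i + 2, 2 * j))
      (φ (2 * i + 2, 2 * j + 2)) (φ (2 * i, 2 * j + 2)) (x.1 - 2 * i) (x.2 - 2 * j) := by
  have fl : ∀ (y : ℝ) (k : ℤ), 2 * k ≤ y → y ≤ 2 * k + 2 →
      ⌊y / 2⌋ = k ∨ (⌊y / 2⌋ = k + 1 ∧ y = 2 * k + 2) := by
    intro y k h1 h2
    rcases h2.lt_or_eq with h | h
    · left
      rw [Int.floor_eq_iff]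
      constructor <;> linarith
    · right
      refine ⟨?_, h⟩
      rw [Int.floor_eq_iff, h]
      push_cast
      constructor <;> linarith
  obtain ⟨x, y⟩ := x
  simp only at *
  simp only [interp]
  rcases fl x i hi hi' with ex | ⟨ex, rfl⟩ <;> rcases fl y j hj hj' with ey | ⟨ey, rfl⟩ <;>
    rw [ex, ey]
  · push_cast
    rw [show (2 * (j : ℝ) + 2 - 2 * (j + 1)) = 0 by ring, show (2 * (j : ℝ) + 2 - 2 * j) = 2 by ring,
      squareInterp_top _ _ _ _ (by linarith) (by linarith),
      squareInterp_bottom _ _ _ _ (by linarith) (by linarith)]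
    simp only [mul_add, mul_one]
  · push_cast
    rw [show (2 * (i : ℝ) + 2 - 2 * (i + 1)) = 0 by ring, show (2 * (i : ℝ) + 2 - 2 * i) = 2 by ring,
      squareInterp_left _ _ _ _ (by linarith) (by linarith),
      squareInterp_right _ _ _ _ (by linarith) (by linarith)]
    simp only [mul_add, mul_one]
  · push_cast
    rw [show (2 * (j : ℝ) + 2 - 2 * (j + 1)) = 0 by ring, show (2 * (j : ℝ) + 2 - 2 * j) = 2 by ring,
      show (2 * (i : ℝ) + 2 - 2 * (i + 1)) = 0 by ring, show (2 * (i : ℝ) + 2 - 2 * i) = 2 by ring,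
      squareInterp_left _ _ _ _ le_rfl zero_le_two, squareInterp_right _ _ _ _ zero_le_two le_rfl]
    simp only [mul_add, mul_one]
    ring

/-- A Lipschitz bound on each strip `2 i ≤ ℓ ≤ 2 i + 2` of a convex set holds on the whole set:
a segment is cut at the lines `ℓ = 2 i`. -/
theorem dist_le_of_strips {f : ℝ × ℝ → ℝ} {K : ℝ} {C : Set (ℝ × ℝ)} (hC : Convex ℝ C)
    (ℓ : ℝ × ℝ →ₗ[ℝ] ℝ)
    (h : ∀ i : ℤ, ∀ p ∈ C, ∀ q ∈ C, 2 * i ≤ ℓ p → ℓ p ≤ 2 * i + 2 → 2 * i ≤ ℓ q →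
      ℓ q ≤ 2 * i + 2 → dist (f p) (f q) ≤ K * dist p q) :
    ∀ p ∈ C, ∀ q ∈ C, dist (f p) (f q) ≤ K * dist p q := by
  have key : ∀ (N : ℕ) (i : ℤ), ∀ p ∈ C, ∀ q ∈ C, 2 * i ≤ ℓ p → ℓ p ≤ 2 * i + 2 →
      2 * i ≤ ℓ q → ℓ q ≤ 2 * i + 2 + 2 * N → dist (f p) (f q) ≤ K * dist p q := by
    intro N
    induction N with
    | zero =>
      intro i p hp q hq h1 h2 h3 h4
      exact h i p hp q hq h1 h2 h3 (by simpa using h4)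
    | succ N ih =>
      intro i p hp q hq h1 h2 h3 h4
      push_cast at h4
      rcases le_or_gt (ℓ q) (2 * i + 2 + 2 * N) with h5 | h5
      · exact ih i p hp q hq h1 h2 h3 h5
      have hN : (0 : ℝ) ≤ N := N.cast_nonneg
      have hpq : 0 < ℓ q - ℓ p := by linarith
      set c : ℝ := (2 * i + 2 + 2 * N - ℓ p) / (ℓ q - ℓ p) with hc
      have hc0 : 0 ≤ c := div_nonneg (by linarith) hpq.le
      have hc1 : c ≤ 1 := (div_le_one hpq).2 (by linarith)
      have hr : AffineMap.lineMap p q c ∈ C := hC.lineMap_mem hp hq ⟨hc0, hc1⟩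
      have hℓ : ℓ (AffineMap.lineMap p q c) = 2 * i + 2 + 2 * N := by
        simp only [AffineMap.lineMap_apply, vsub_eq_sub, vadd_eq_add, map_add, map_smul, map_sub,
          smul_eq_mul]
        rw [hc, div_mul_cancel₀ _ hpq.ne']
        ring
      have d1 := ih i p hp _ hr h1 h2 (by rw [hℓ]; linarith) hℓ.le
      have d2 := h (i + 1 + N) _ hr q hq (by rw [hℓ]; push_cast; linarith)
        (by rw [hℓ]; push_cast; linarith) (by push_cast; linarith) (by push_cast; linarith)
      rw [dist_left_lineMap, Real.norm_of_nonneg hc0] at d1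
      rw [dist_lineMap_right, Real.norm_of_nonneg (sub_nonneg.2 hc1)] at d2
      calc dist (f p) (f q) ≤ _ := dist_triangle _ _ _
        _ ≤ _ := add_le_add d1 d2
        _ = K * dist p q := by ring
  have main : ∀ p ∈ C, ∀ q ∈ C, ℓ p ≤ ℓ q → dist (f p) (f q) ≤ K * dist p q := by
    intro p hp q hq hpq
    obtain ⟨N, hN⟩ := exists_nat_ge ((ℓ q - ℓ p) / 2)
    have h1 := Int.floor_le (ℓ p / 2)
    have h2 := Int.lt_floor_add_one (ℓ p / 2)
    exact key N ⌊ℓ p / 2⌋ p hp q hq (by linarith) (by linarith) (by linarith) (by linarith)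
  intro p hp q hq
  rcases le_total (ℓ p) (ℓ q) with h | h
  · exact main p hp q hq h
  · rw [dist_comm (f p), dist_comm p]
    exact main q hq p hp h

theorem IsAdmissible.corner {φ : ℤ × ℤ → ℤ} (hφ : IsAdmissible φ) (i j : ℤ) :
    ∃ m : ℤ, (φ (2 * i, 2 * j) = m - 2 ∨ φ (2 * i, 2 * j) = m + 2) ∧
      (φ (2 * i + 2, 2 * j) = m - 2 ∨ φ (2 * i + 2, 2 * j) = m + 2) ∧
      (φ (2 * i + 2, 2 * j + 2) = m - 2 ∨ φ (2 * i + 2, 2 * j + 2) = m + 2) ∧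
      (φ (2 * i, 2 * j + 2) = m - 2 ∨ φ (2 * i, 2 * j + 2) = m + 2) := by
  refine ⟨φ (2 * i + 1, 2 * j + 1), ?_⟩
  obtain ⟨c1, c2, c3, c4⟩ := hφ.2 (2 * i + 1) (2 * j + 1) (by rw [Int.even_iff]; omega)
  obtain ⟨p1, -, p3, -⟩ := hφ.2 (2 * i) (2 * j) (by rw [Int.even_iff]; omega)
  obtain ⟨-, q2, q3, -⟩ := hφ.2 (2 * i + 2) (2 * j) (by rw [Int.even_iff]; omega)
  obtain ⟨-, r2, -, r4⟩ := hφ.2 (2 * i + 2) (2 * j + 2) (by rw [Int.even_iff]; omega)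
  obtain ⟨s1, -, -, s4⟩ := hφ.2 (2 * i) (2 * j + 2) (by rw [Int.even_iff]; omega)
  rw [show 2 * i + 1 + 1 = 2 * i + 2 by ring] at c1
  rw [show 2 * i + 1 - 1 = 2 * i by ring] at c2
  rw [show 2 * j + 1 + 1 = 2 * j + 2 by ring] at c3
  rw [show 2 * j + 1 - 1 = 2 * j by ring] at c4
  rw [show 2 * i + 2 - 1 = 2 * i + 1 by ring] at q2 r2
  rw [show 2 * j + 2 - 1 = 2 * j + 1 by ring] at r4 s4
  refine ⟨?_, ?_, ?_, ?_⟩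
  · clear c1 c3 q2 q3 r2 r4 s1 s4
    omega
  · clear c2 c3 p1 p3 r2 r4 s1 s4
    omega
  · clear c2 c4 p1 p3 q2 q3 s1 s4
    omega
  · clear c1 c4 p1 p3 q2 q3 r2 r4
    omega

/-- The interpolation of an admissible height function is an asymptotic height function. -/
theorem IsAdmissible.isLip_interp {φ : ℤ × ℤ → ℤ} (hφ : IsAdmissible φ) : IsLip (interp φ) := by
  have hrow : ∀ j : ℤ, ∀ p ∈ {p : ℝ × ℝ | 2 * j ≤ p.2 ∧ p.2 ≤ 2 * j + 2},
      ∀ q ∈ {p : ℝ × ℝ | 2 * j ≤ p.2 ∧ p.2 ≤ 2 * j + 2},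
      dist (interp φ p) (interp φ q) ≤ 2 * dist p q := by
    intro j
    have hconv : Convex ℝ {p : ℝ × ℝ | 2 * j ≤ p.2 ∧ p.2 ≤ 2 * j + 2} :=
      (convex_Icc (2 * (j : ℝ)) (2 * j + 2)).linear_preimage (LinearMap.snd ℝ ℝ ℝ)
    refine dist_le_of_strips hconv (LinearMap.fst ℝ ℝ ℝ) ?_
    intro i p hp q hq h1 h2 h3 h4
    simp only [LinearMap.fst_apply] at h1 h2 h3 h4
    rw [interp_eq φ h1 h2 hp.1 hp.2, interp_eq φ h3 h4 hq.1 hq.2, Real.dist_eq]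
    obtain ⟨m, h00, h20, h22, h02⟩ := hφ.corner i j
    have cast : ∀ k : ℤ, (k = m - 2 ∨ k = m + 2) → ((k : ℝ) = m - 2 ∨ (k : ℝ) = m + 2) := by
      rintro k (rfl | rfl) <;> simp
    have := squareInterp_lip (cast _ h00) (cast _ h20) (cast _ h22) (cast _ h02)
      (p.1 - 2 * i) (p.2 - 2 * j) (q.1 - 2 * i) (q.2 - 2 * j)
    rwa [sub_sub_sub_cancel_right, sub_sub_sub_cancel_right] at this
  have hall := dist_le_of_strips convex_univ (LinearMap.snd ℝ ℝ ℝ) (f := interp φ) (K := 2)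
    (fun j p _ q _ h1 h2 h3 h4 => hrow j p ⟨h1, h2⟩ q ⟨h3, h4⟩)
  exact fun p q => hall p trivial q trivial

theorem interp_add (φ : ℤ × ℤ → ℤ) (m : ℤ) (x : ℝ × ℝ) :
    interp (fun z => φ z + m) x = interp φ x + m := by
  simp only [interp, Int.cast_add, squareInterp_add]

theorem floor_half_bounds (y : ℝ) : 0 ≤ y - 2 * ⌊y / 2⌋ ∧ y - 2 * ⌊y / 2⌋ ≤ 2 := by
  have h1 := Int.floor_le (y / 2)
  have h2 := Int.lt_floor_add_one (y / 2)
  constructor <;> linarith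

theorem interp_mono {φ ψ : ℤ × ℤ → ℤ} (h : ∀ z, φ z ≤ ψ z) (x : ℝ × ℝ) :
    interp φ x ≤ interp ψ x := by
  have key : ∀ z, (φ z : ℝ) ≤ ψ z := fun z => Int.cast_le.2 (h z)
  exact squareInterp_mono (key _) (key _) (key _) (key _) (floor_half_bounds _).1
    (floor_half_bounds _).2 (floor_half_bounds _).1 (floor_half_bounds _).2

/-- The corners of the square containing `x` are even faces at `ℓ^∞` distance at most `2`
from `x`. -/
theorem corners_of_near {P : ℤ × ℤ → Prop} {x : ℝ × ℝ}
    (h : ∀ z : ℤ × ℤ, Even (z.1 + z.2) → |(z.1 : ℝ) - x.1| ≤ 2 → |(z.2 : ℝ) - x.2| ≤ 2 → P z) :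
    P (2 * ⌊x.1 / 2⌋, 2 * ⌊x.2 / 2⌋) ∧ P (2 * ⌊x.1 / 2⌋ + 2, 2 * ⌊x.2 / 2⌋) ∧
      P (2 * ⌊x.1 / 2⌋ + 2, 2 * ⌊x.2 / 2⌋ + 2) ∧ P (2 * ⌊x.1 / 2⌋, 2 * ⌊x.2 / 2⌋ + 2) := by
  obtain ⟨a1, a2⟩ := floor_half_bounds x.1
  obtain ⟨b1, b2⟩ := floor_half_bounds x.2
  refine ⟨h _ ?_ ?_ ?_, h _ ?_ ?_ ?_, h _ ?_ ?_ ?_, h _ ?_ ?_ ?_⟩ <;>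
    first
    | (rw [Int.even_iff]; omega)
    | (push_cast; rw [abs_le]; constructor <;> linarith)

theorem interp_bounds {φ : ℤ × ℤ → ℤ} {x : ℝ × ℝ} {a b : ℝ}
    (h : ∀ z : ℤ × ℤ, Even (z.1 + z.2) → |(z.1 : ℝ) - x.1| ≤ 2 → |(z.2 : ℝ) - x.2| ≤ 2 →
      a ≤ φ z ∧ φ z ≤ b) : a ≤ interp φ x ∧ interp φ x ≤ b := by
  obtain ⟨h1, h2, h3, h4⟩ := corners_of_near h
  have fx := floor_half_bounds x.1
  have fy := floor_half_bounds x.2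
  constructor
  · rw [← squareInterp_const a (x.1 - 2 * ⌊x.1 / 2⌋) (x.2 - 2 * ⌊x.2 / 2⌋)]
    exact squareInterp_mono h1.1 h2.1 h3.1 h4.1 fx.1 fx.2 fy.1 fy.2
  · rw [← squareInterp_const b (x.1 - 2 * ⌊x.1 / 2⌋) (x.2 - 2 * ⌊x.2 / 2⌋)]
    exact squareInterp_mono h1.2 h2.2 h3.2 h4.2 fx.1 fx.2 fy.1 fy.2

theorem interp_congr {φ ψ : ℤ × ℤ → ℤ} {x : ℝ × ℝ}
    (h : ∀ z : ℤ × ℤ, |(z.1 : ℝ) - x.1| ≤ 2 → |(z.2 : ℝ) - x.2| ≤ 2 → φ z = ψ z) :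
    interp φ x = interp ψ x := by
  obtain ⟨h1, h2, h3, h4⟩ := corners_of_near (P := fun z => φ z = ψ z) fun z _ => h z
  simp only [interp, h1, h2, h3, h4]

/-! ### The discrete evolution -/

theorem IsLip.sub_const {g : ℝ × ℝ → ℝ} (hg : IsLip g) (m : ℝ) : IsLip fun x => g x - m := by
  simpa only [sub_eq_add_neg] using hg.add_const (-m)

theorem discreteS_of_le {n k l : ℕ} (h : l ≤ k) (g : ℝ × ℝ → ℝ) (ω : Marks) :
    discreteS n k l g ω = g := by
  funext x
  exact if_neg (not_lt.2 h)

theorem discreteS_of_lt {n k l : ℕ} (h : k < l) (g : ℝ × ℝ → ℝ) (ω : Marks) (x : ℝ × ℝ) :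
    discreteS n k l g ω x = 1 / (n : ℝ) *
      interp (height (initialHeight n g) (timeShift k ω) (l - k)) (n * x.1, n * x.2) := if_pos h

theorem isLip_rescaled {n : ℕ} (hn : 0 < n) {f : ℝ × ℝ → ℝ} (hf : IsLip f) :
    IsLip fun x => 1 / (n : ℝ) * f (n * x.1, n * x.2) := by
  intro x y
  have hn' : (0 : ℝ) < n := Nat.cast_pos.2 hn
  have := hf (n * x.1, n * x.2) (n * y.1, n * y.2)
  simp only [← mul_sub, abs_mul, Nat.abs_cast, abs_div, abs_one] at this ⊢
  rw [← mul_max_of_nonneg _ _ hn'.le] at this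
  rw [one_div, inv_mul_le_iff₀ hn']
  linarith

theorem isLip_discreteS {n : ℕ} (hn : 0 < n) (k l : ℕ) {g : ℝ × ℝ → ℝ} (hg : IsLip g) (ω : Marks) :
    IsLip (discreteS n k l g ω) := by
  rcases lt_or_ge k l with h | h
  · have := isLip_rescaled hn ((isAdmissible_initialHeight hn hg).height (timeShift k ω)
      (l - k)).isLip_interp
    intro x y
    rw [discreteS_of_lt h, discreteS_of_lt h]
    exact this x y
  · rwa [discreteS_of_le h]

theorem discreteS_mono {n : ℕ} (hn : 0 < n) (k l : ℕ) {g₁ g₂ : ℝ × ℝ → ℝ} (h₁ : IsLip g₁)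
    (h₂ : IsLip g₂) (h : ∀ x, g₁ x ≤ g₂ x) (ω : Marks) (x : ℝ × ℝ) :
    discreteS n k l g₁ ω x ≤ discreteS n k l g₂ ω x := by
  rcases lt_or_ge k l with hkl | hkl
  · rw [discreteS_of_lt hkl, discreteS_of_lt hkl]
    refine mul_le_mul_of_nonneg_left (interp_mono (height_mono (isAdmissible_initialHeight hn h₁)
      (isAdmissible_initialHeight hn h₂) (initialHeight_mono hn h₁ h₂ h) _ _) _) (by positivity)
  · rw [discreteS_of_le hkl, discreteS_of_le hkl]
    exact h x

/-- Raising the profile by a multiple of `4 / n` commutes with the discrete evolution. -/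
theorem discreteS_add {n : ℕ} (hn : 0 < n) (k l : ℕ) {g : ℝ × ℝ → ℝ} (hg : IsLip g) (ω : Marks)
    (m : ℤ) (x : ℝ × ℝ) :
    discreteS n k l (fun x => g x + 4 * m / n) ω x = discreteS n k l g ω x + 4 * m / n := by
  rcases lt_or_ge k l with hkl | hkl
  · have hn' : (n : ℝ) ≠ 0 := Nat.cast_ne_zero.2 hn.ne'
    rw [discreteS_of_lt hkl, discreteS_of_lt hkl, initialHeight_add hn hg, height_add, interp_add]
    push_cast
    field_simp
  · rw [discreteS_of_le hkl, discreteS_of_le hkl]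

/-- Finite range of dependence of the discrete evolution, in the profile and in the marks. -/
theorem discreteS_congr {n : ℕ} (hn : 0 < n) {k l : ℕ} {g₁ g₂ : ℝ × ℝ → ℝ} (h₁ : IsLip g₁)
    (h₂ : IsLip g₂) {ω ω' : Marks} {x : ℝ × ℝ}
    (hg : ∀ y, l1 (y - x) ≤ (2 * (l - k : ℕ) + 5) / n → g₁ y = g₂ y)
    (hω : ∀ z : ℤ × ℤ, |z.1 - n * x.1| + |z.2 - n * x.2| ≤ 2 * (l - k : ℕ) + 4 →
      ∀ s ≤ l, ω (z, s) = ω' (z, s)) :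
    discreteS n k l g₁ ω x = discreteS n k l g₂ ω' x := by
  have hn' : (0 : ℝ) < n := Nat.cast_pos.2 hn
  rcases lt_or_ge k l with hkl | hkl
  · rw [discreteS_of_lt hkl, discreteS_of_lt hkl]
    congr 1
    refine interp_congr fun z hz1 hz2 => height_congr fun w hw => ?_
    simp only at hz1 hz2
    have cast : ∀ {w z : ℤ × ℤ} {m : ℤ}, latticeDist w z ≤ m →
        |(w.1 : ℝ) - z.1| + |(w.2 : ℝ) - z.2| ≤ m := by
      intro w z m h
      unfold latticeDist at h
      exact_mod_cast h
    have hw' := cast hw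
    push_cast at hw'
    have t1 := abs_sub_le (w.1 : ℝ) z.1 (n * x.1)
    have t2 := abs_sub_le (w.2 : ℝ) z.2 (n * x.2)
    refine ⟨initialHeight_congr hn h₁ h₂ fun v hv => hg _ ?_, fun s _ hs => hω w ?_ _ (by omega)⟩
    · have hv' := cast hv
      have t3 := abs_sub_le (v.1 : ℝ) w.1 (n * x.1)
      have t4 := abs_sub_le (v.2 : ℝ) w.2 (n * x.2)
      have e : ∀ a b : ℝ, |a / n - b| = |a - n * b| / n := by
        intro a b
        rw [← abs_of_pos hn', ← abs_div, abs_of_pos hn']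
        congr 1
        field_simp
      simp only [l1, Prod.fst_sub, Prod.snd_sub, e, ← add_div]
      rw [div_le_div_iff_of_pos_right hn']
      push_cast at hv'
      linarith
    · linarith
  · rw [discreteS_of_le hkl, discreteS_of_le hkl]
    refine hg x ?_
    simp only [sub_self, l1, Prod.fst_zero, Prod.snd_zero, abs_zero, add_zero]
    positivity

theorem discreteS_bounds {n : ℕ} (hn : 0 < n) (k l : ℕ) {g : ℝ × ℝ → ℝ} (hg : IsLip g) (ω : Marks)
    (x : ℝ × ℝ) : g x - (8 + 4 * (l - k : ℕ)) / n ≤ discreteS n k l g ω x ∧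
      discreteS n k l g ω x ≤ g x + 4 / n := by
  have hn' : (0 : ℝ) < n := Nat.cast_pos.2 hn
  rcases lt_or_ge k l with hkl | hkl
  · have hx : ∀ z : ℤ × ℤ, Even (z.1 + z.2) → |(z.1 : ℝ) - n * x.1| ≤ 2 →
        |(z.2 : ℝ) - n * x.2| ≤ 2 →
        n * g x - (8 + 4 * (l - k : ℕ)) ≤
          height (initialHeight n g) (timeShift k ω) (l - k) z ∧
        height (initialHeight n g) (timeShift k ω) (l - k) z ≤ n * g x + 4 := by
      intro z hz h1 h2
      have hb := height_bounds (initialHeight n g) (timeShift k ω) (l - k) z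
      rw [initialHeight_of_even hn hg hz] at hb
      have hb1 : (roundDown n g z : ℝ) - 4 * (l - k : ℕ) ≤
        height (initialHeight n g) (timeShift k ω) (l - k) z := by exact_mod_cast hb.1
      have hb2 : (height (initialHeight n g) (timeShift k ω) (l - k) z : ℝ) ≤
        roundDown n g z := by exact_mod_cast hb.2
      have r1 := roundDown_le n g z
      have r2 := lt_roundDown_add n g z
      have hs := (hg.scaled hn z.1 z.2 (n * x.1) (n * x.2)).trans
        (mul_le_mul_of_nonneg_left (max_le h1 h2) zero_le_two)
      rw [mul_div_cancel_left₀ _ hn'.ne', mul_div_cancel_left₀ _ hn'.ne', abs_le] at hs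
      constructor <;> linarith
    obtain ⟨h1, h2⟩ := interp_bounds (x := (n * x.1, n * x.2)) hx
    rw [discreteS_of_lt hkl, ← sub_nonneg, ← sub_nonneg (b := _ * _)]
    constructor
    · rw [show ∀ a : ℝ, 1 / (n : ℝ) * a - (g x - (8 + 4 * (l - k : ℕ)) / n) =
        (a - (n * g x - (8 + 4 * (l - k : ℕ)))) / n from fun a => by field_simp]
      exact div_nonneg (sub_nonneg.2 h1) hn'.le
    · rw [show ∀ a : ℝ, g x + 4 / n - 1 / (n : ℝ) * a = (n * g x + 4 - a) / n from
        fun a => by field_simp]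
      exact div_nonneg (sub_nonneg.2 h2) hn'.le
  · rw [discreteS_of_le hkl]
    constructor
    · exact sub_le_self _ (by positivity)
    · exact le_add_of_nonneg_right (by positivity)

/-- At the origin the interpolation is exact, which improves the constant. -/
theorem abs_discreteS_zero_sub_le {n : ℕ} (hn : 0 < n) (k l : ℕ) {g : ℝ × ℝ → ℝ} (hg : IsLip g)
    (ω : Marks) : |discreteS n k l g ω (0, 0) - g (0, 0)| ≤ (4 + 4 * (l - k : ℕ)) / n := by
  have hn' : (0 : ℝ) < n := Nat.cast_pos.2 hn
  rcases lt_or_ge k l with hkl | hkl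
  · have h0 : ∀ φ : ℤ × ℤ → ℤ, interp φ (0, 0) = φ (0, 0) := by
      intro φ
      simp [interp, squareInterp]
    have hb := height_bounds (initialHeight n g) (timeShift k ω) (l - k) (0, 0)
    rw [initialHeight_of_even hn hg (by simp)] at hb
    have hb1 : (roundDown n g (0, 0) : ℝ) - 4 * (l - k : ℕ) ≤
        height (initialHeight n g) (timeShift k ω) (l - k) (0, 0) := by exact_mod_cast hb.1
    have hb2 : (height (initialHeight n g) (timeShift k ω) (l - k) (0, 0) : ℝ) ≤
        roundDown n g (0, 0) := by exact_mod_cast hb.2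
    have r1 := roundDown_le n g (0, 0)
    have r2 := lt_roundDown_add n g (0, 0)
    rw [Int.cast_zero, zero_div] at r1 r2
    rw [discreteS_of_lt hkl, mul_zero, h0, show ∀ a : ℝ, 1 / (n : ℝ) * a - g (0, 0) =
      (a - n * g (0, 0)) / n from fun a => by field_simp, abs_div, abs_of_pos hn',
      div_le_div_iff_of_pos_right hn', abs_le]
    constructor <;> linarith
  · rw [discreteS_of_le hkl, sub_self, abs_zero]
    positivity

theorem rescaled_interp_le {n : ℕ} {f₁ f₂ : ℤ × ℤ → ℤ} {m : ℤ} (h : ∀ z, f₁ z ≤ f₂ z + m)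
    (x : ℝ × ℝ) : 1 / (n : ℝ) * interp f₁ x ≤ 1 / (n : ℝ) * interp f₂ x + m / n := by
  have := interp_mono h x
  rw [interp_add] at this
  calc 1 / (n : ℝ) * interp f₁ x ≤ 1 / (n : ℝ) * (interp f₂ x + m) :=
        mul_le_mul_of_nonneg_left this (by positivity)
    _ = _ := by ring

theorem abs_discreteS_succ_right_sub_le {n : ℕ} (hn : 0 < n) (k l : ℕ) {g : ℝ × ℝ → ℝ}
    (hg : IsLip g) (ω : Marks) (x : ℝ × ℝ) :
    |discreteS n k (l + 1) g ω x - discreteS n k l g ω x| ≤ 12 / n := by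
  have hn' : (0 : ℝ) < n := Nat.cast_pos.2 hn
  rcases lt_trichotomy k l with h | rfl | h
  · rw [discreteS_of_lt h, discreteS_of_lt (h.trans (Nat.lt_succ_self l)), Nat.succ_sub h.le]
    have hb := height_succ_bounds (initialHeight n g) (timeShift k ω) (l - k)
    have h1 := rescaled_interp_le (n := n) (m := 4) (fun z => (sub_le_iff_le_add.1 (hb z).1))
      (n * x.1, n * x.2)
    have h2 := rescaled_interp_le (n := n) (m := 0) (fun z => by simpa using (hb z).2)
      (n * x.1, n * x.2)
    push_cast at h1 h2
    have : (4 : ℝ) / n ≤ 12 / n := by gcongr; norm_num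
    rw [zero_div] at h2
    rw [Nat.succ_eq_add_one, abs_le]
    constructor <;> linarith
  · rw [discreteS_of_le le_rfl]
    have h := discreteS_bounds hn k (k + 1) hg ω x
    rw [Nat.add_sub_cancel_left, Nat.cast_one] at h
    norm_num at h
    have : (4 : ℝ) / n ≤ 12 / n := by gcongr; norm_num
    rw [abs_le]
    constructor <;> linarith
  · rw [discreteS_of_le h.le, discreteS_of_le h, sub_self, abs_zero]
    positivity

theorem abs_discreteS_succ_left_sub_le {n : ℕ} (hn : 0 < n) (k l : ℕ) {g : ℝ × ℝ → ℝ}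
    (hg : IsLip g) (ω : Marks) (x : ℝ × ℝ) :
    |discreteS n (k + 1) l g ω x - discreteS n k l g ω x| ≤ 12 / n := by
  have hn' : (0 : ℝ) < n := Nat.cast_pos.2 hn
  rcases lt_trichotomy (k + 1) l with h | rfl | h
  · rw [discreteS_of_lt h, discreteS_of_lt (k.lt_succ_self.trans h)]
    -- the evolution started one step earlier is the later one, started from a shuffled height
    have hA := isAdmissible_initialHeight hn hg
    have hA1 := hA.height (timeShift k ω) 1
    have hA4 := isAdmissible_initialHeight hn (hg.add_const (4 * (-1 : ℤ) / n))
    rw [initialHeight_add hn hg] at hA4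
    have hb := height_succ_bounds (initialHeight n g) (timeShift k ω) 0
    simp only [height, zero_add] at hb
    have hco := height_height (initialHeight n g) (timeShift k ω) 1 (l - (k + 1))
    rw [timeShift_timeShift, show 1 + (l - (k + 1)) = l - k by omega] at hco
    have h1 := height_mono hA4 hA1 (fun z => (hb z).1) (timeShift (k + 1) ω) (l - (k + 1))
    have h2 := height_mono hA1 hA (fun z => (hb z).2) (timeShift (k + 1) ω) (l - (k + 1))
    rw [hco] at h1 h2
    simp only [height_add] at h1
    have h1 := rescaled_interp_le (n := n) (m := 4)
      (fun z => by have := h1 z; omega : ∀ z, height (initialHeight n g) (timeShift (k + 1) ω)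
        (l - (k + 1)) z ≤ height (initialHeight n g) (timeShift k ω) (l - k) z + 4)
      (n * x.1, n * x.2)
    have h2 := rescaled_interp_le (n := n) (m := 0) (fun z => by simpa using h2 z)
      (n * x.1, n * x.2)
    push_cast at h1 h2
    have : (4 : ℝ) / n ≤ 12 / n := by gcongr; norm_num
    rw [zero_div] at h2
    rw [abs_le]
    constructor <;> linarith
  · rw [discreteS_of_le le_rfl, abs_sub_comm]
    have h := discreteS_bounds hn k (k + 1) hg ω x
    rw [Nat.add_sub_cancel_left, Nat.cast_one] at h
    norm_num at h
    have : (4 : ℝ) / n ≤ 12 / n := by gcongr; norm_num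
    rw [abs_le]
    constructor <;> linarith
  · rw [discreteS_of_le h.le, discreteS_of_le (by omega), sub_self, abs_zero]
    positivity

/-- The discrete evolution has the semigroup property up to the rounding of the intermediate
profile. -/
theorem abs_discreteS_discreteS_sub_le {n : ℕ} (hn : 0 < n) {k l m : ℕ} (hkl : k ≤ l) (hlm : l ≤ m)
    {g : ℝ × ℝ → ℝ} (hg : IsLip g) (ω : Marks) (x : ℝ × ℝ) :
    |discreteS n l m (discreteS n k l g ω) ω x - discreteS n k m g ω x| ≤ 12 / n := by
  have hn' : (0 : ℝ) < n := Nat.cast_pos.2 hn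
  rcases hkl.eq_or_lt with rfl | hkl'
  · rw [discreteS_of_le (le_refl k), sub_self, abs_zero]
    positivity
  rcases hlm.eq_or_lt with rfl | hlm'
  · rw [discreteS_of_le (le_refl l), sub_self, abs_zero]
    positivity
  rw [discreteS_of_lt hlm', discreteS_of_lt (hkl'.trans hlm')]
  have hA := (isAdmissible_initialHeight hn hg).height (timeShift k ω) (l - k)
  have hL := isLip_discreteS hn k l hg ω
  have hI := isAdmissible_initialHeight hn hL
  have hco := height_height (initialHeight n g) (timeShift k ω) (l - k) (m - l)
  rw [timeShift_timeShift, show k + (l - k) = l by omega,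
    show l - k + (m - l) = m - k by omega] at hco
  set φ := height (initialHeight n g) (timeShift k ω) (l - k) with hφ
  set ψ := initialHeight n (discreteS n k l g ω) with hψ
  have near : ∀ z, φ z - 12 ≤ ψ z ∧ ψ z ≤ φ z + 12 := by
    intro z
    have h1 := abs_initialHeight_sub_le hn hL z
    rw [discreteS_of_lt hkl', mul_div_cancel₀ _ hn'.ne', mul_div_cancel₀ _ hn'.ne', ← hφ, ← hψ,
      ← mul_assoc, mul_one_div_cancel hn'.ne', one_mul, abs_le] at h1
    have h2 := abs_lt.1 (isInterpBound_four φ hA z)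
    constructor
    · have : (φ z : ℝ) - 12 ≤ ψ z := by linarith
      exact_mod_cast this
    · have : (ψ z : ℝ) ≤ φ z + 12 := by linarith
      exact_mod_cast this
  have hup : IsAdmissible fun z => ψ z + 4 * 3 := by
    have := isAdmissible_initialHeight hn (hL.add_const (4 * (3 : ℤ) / n))
    rwa [initialHeight_add hn hL] at this
  have hdown : IsAdmissible fun z => ψ z + 4 * (-3) := by
    have := isAdmissible_initialHeight hn (hL.add_const (4 * (-3 : ℤ) / n))
    rwa [initialHeight_add hn hL] at this
  have h1 := height_mono hA hup (fun z => by have := (near z).1; omega) (timeShift l ω) (m - l)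
  have h2 := height_mono hdown hA (fun z => by have := (near z).2; omega) (timeShift l ω) (m - l)
  rw [hco] at h1 h2
  simp only [height_add] at h1 h2
  have h1 := rescaled_interp_le (n := n) (m := 12) h1 (n * x.1, n * x.2)
  have h2 := rescaled_interp_le (n := n) (m := 12)
    (fun z => by have := h2 z; omega : ∀ z, height ψ (timeShift l ω) (m - l) z ≤
      height (initialHeight n g) (timeShift k ω) (m - k) z + 12) (n * x.1, n * x.2)
  push_cast at h1 h2
  rw [abs_le]
  constructor <;> linarith

/-! ### Averaging over the rounding -/

/-- The integrand of the averaged evolution, without the normalisation at the origin. -/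
def shiftedS (n k l : ℕ) (g : ℝ × ℝ → ℝ) (ω : Marks) (x : ℝ × ℝ) (u : ℝ) : ℝ :=
  discreteS n k l (fun y => g y - u / n) ω x + u / n

theorem intervalIntegrable_shiftedS {n : ℕ} (hn : 0 < n) (k l : ℕ) {g : ℝ × ℝ → ℝ} (hg : IsLip g)
    (ω : Marks) (x : ℝ × ℝ) (a b : ℝ) :
    IntervalIntegrable (shiftedS n k l g ω x) volume a b := by
  have anti : Antitone fun u : ℝ => discreteS n k l (fun y => g y - u / n) ω x := by
    intro u v huv
    refine discreteS_mono hn k l (hg.sub_const _) (hg.sub_const _) (fun y => ?_) ω x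
    gcongr
  exact anti.intervalIntegrable.add ((continuous_id.div_const _).intervalIntegrable _ _)

theorem shiftedS_periodic {n : ℕ} (hn : 0 < n) (k l : ℕ) {g : ℝ × ℝ → ℝ} (hg : IsLip g)
    (ω : Marks) (x : ℝ × ℝ) : Function.Periodic (shiftedS n k l g ω x) 4 := by
  intro u
  have h := discreteS_add hn k l (hg.sub_const (u / n)) ω (-1) x
  unfold shiftedS
  rw [show (fun y => g y - (u + 4) / n) = fun y => g y - u / n + 4 * ((-1 : ℤ) : ℝ) / n by
    funext y; push_cast; ring, h]
  push_cast
  ring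

/-- By periodicity the normalisation at the origin does not affect the average. -/
theorem averagedS_eq {n : ℕ} (hn : 0 < n) (k l : ℕ) {g : ℝ × ℝ → ℝ} (hg : IsLip g)
    (ω : Marks) (x : ℝ × ℝ) :
    averagedS n k l g ω x = 1 / 4 * ∫ u in (0 : ℝ)..4, shiftedS n k l g ω x u := by
  have hn' : (n : ℝ) ≠ 0 := Nat.cast_ne_zero.2 hn.ne'
  have h1 : ∀ u : ℝ, discreteS n k l (fun y => g y - g (0, 0) - u / n) ω x + u / n =
      shiftedS n k l g ω x (u + n * g (0, 0)) - g (0, 0) := by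
    intro u
    unfold shiftedS
    rw [show (fun y => g y - g (0, 0) - u / n) = fun y => g y - (u + n * g (0, 0)) / n by
      funext y; rw [add_div, mul_div_cancel_left₀ _ hn']; ring, add_div,
      mul_div_cancel_left₀ _ hn']
    ring
  have hI : IntervalIntegrable (fun u => shiftedS n k l g ω x (u + n * g (0, 0))) volume 0 4 := by
    simpa using (intervalIntegrable_shiftedS hn k l hg ω x (0 + n * g (0, 0))
      (4 + n * g (0, 0))).comp_add_right (n * g (0, 0))
  unfold averagedS
  simp only [h1]
  rw [intervalIntegral.integral_sub hI (by simp), intervalIntegral.integral_const,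
    intervalIntegral.integral_comp_add_right (fun u => shiftedS n k l g ω x u), zero_add, add_comm 4,
    (shiftedS_periodic hn k l hg ω x).intervalIntegral_add_eq _ 0, zero_add]
  simp only [sub_zero, smul_eq_mul]
  ring

theorem average_mono {F G : ℝ → ℝ} (hF : IntervalIntegrable F volume 0 4)
    (hG : IntervalIntegrable G volume 0 4) (h : ∀ u, 0 ≤ u → u ≤ 4 → F u ≤ G u) :
    1 / 4 * ∫ u in (0 : ℝ)..4, F u ≤ 1 / 4 * ∫ u in (0 : ℝ)..4, G u :=
  mul_le_mul_of_nonneg_left (intervalIntegral.integral_mono_on (by norm_num) hF hG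
    fun u hu => h u hu.1 hu.2) (by norm_num)

theorem average_add_const {F : ℝ → ℝ} (hF : IntervalIntegrable F volume 0 4) (c : ℝ) :
    1 / 4 * ∫ u in (0 : ℝ)..4, (F u + c) = 1 / 4 * (∫ u in (0 : ℝ)..4, F u) + c := by
  rw [intervalIntegral.integral_add hF (by simp), intervalIntegral.integral_const]
  simp only [sub_zero, smul_eq_mul]
  ring

theorem abs_average_sub_le {F G : ℝ → ℝ} (hF : IntervalIntegrable F volume 0 4)
    (hG : IntervalIntegrable G volume 0 4) {c : ℝ} (h : ∀ u, 0 ≤ u → u ≤ 4 → |F u - G u| ≤ c) :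
    |1 / 4 * (∫ u in (0 : ℝ)..4, F u) - 1 / 4 * ∫ u in (0 : ℝ)..4, G u| ≤ c := by
  have h1 := average_mono hF (hG.add (by simp : IntervalIntegrable (fun _ => c) volume 0 4))
    fun u h0 h4 => by have := (abs_le.1 (h u h0 h4)).2; linarith
  have h2 := average_mono hG (hF.add (by simp : IntervalIntegrable (fun _ => c) volume 0 4))
    fun u h0 h4 => by have := (abs_le.1 (h u h0 h4)).1; linarith
  rw [average_add_const hG] at h1
  rw [average_add_const hF] at h2
  rw [abs_le]
  constructor <;> linarith

theorem abs_average_sub_const_le {F : ℝ → ℝ} (hF : IntervalIntegrable F volume 0 4) {v c : ℝ}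
    (h : ∀ u, 0 ≤ u → u ≤ 4 → |F u - v| ≤ c) :
    |1 / 4 * (∫ u in (0 : ℝ)..4, F u) - v| ≤ c := by
  have := abs_average_sub_le hF (by simp : IntervalIntegrable (fun _ => v) volume 0 4) h
  rw [intervalIntegral.integral_const, smul_eq_mul, sub_zero, ← mul_assoc] at this
  norm_num at this ⊢
  exact this

theorem averagedS_of_le {n k l : ℕ} (hn : 0 < n) (h : l ≤ k) {g : ℝ × ℝ → ℝ} (hg : IsLip g)
    (ω : Marks) (x : ℝ × ℝ) : averagedS n k l g ω x = g x := by
  rw [averagedS_eq hn k l hg]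
  simp only [shiftedS, discreteS_of_le h, sub_add_cancel, intervalIntegral.integral_const,
    smul_eq_mul]
  ring

theorem isLip_averagedS {n : ℕ} (hn : 0 < n) (k l : ℕ) {g : ℝ × ℝ → ℝ} (hg : IsLip g) (ω : Marks) :
    IsLip (averagedS n k l g ω) := by
  intro x y
  rw [averagedS_eq hn k l hg, averagedS_eq hn k l hg]
  refine abs_average_sub_le (intervalIntegrable_shiftedS hn k l hg ω x _ _)
    (intervalIntegrable_shiftedS hn k l hg ω y _ _) fun u _ _ => ?_
  unfold shiftedS
  rw [add_sub_add_right_eq_sub]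
  exact isLip_discreteS hn k l (hg.sub_const _) ω x y

theorem averagedS_mono {n : ℕ} (hn : 0 < n) (k l : ℕ) {g₁ g₂ : ℝ × ℝ → ℝ} (h₁ : IsLip g₁)
    (h₂ : IsLip g₂) (h : ∀ x, g₁ x ≤ g₂ x) (ω : Marks) (x : ℝ × ℝ) :
    averagedS n k l g₁ ω x ≤ averagedS n k l g₂ ω x := by
  rw [averagedS_eq hn k l h₁, averagedS_eq hn k l h₂]
  refine average_mono (intervalIntegrable_shiftedS hn k l h₁ ω x _ _)
    (intervalIntegrable_shiftedS hn k l h₂ ω x _ _) fun u _ _ => ?_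
  unfold shiftedS
  gcongr
  exact discreteS_mono hn k l (h₁.sub_const _) (h₂.sub_const _) (fun y => sub_le_sub_right (h y) _)
    ω x

theorem averagedS_add (n k l : ℕ) (g : ℝ × ℝ → ℝ) (ω : Marks) (m : ℝ) (x : ℝ × ℝ) :
    averagedS n k l (fun y => g y + m) ω x = averagedS n k l g ω x + m := by
  unfold averagedS
  simp only [add_sub_add_right_eq_sub]
  ring

theorem averagedS_congr {n : ℕ} (hn : 0 < n) {k l : ℕ} {g₁ g₂ : ℝ × ℝ → ℝ} (h₁ : IsLip g₁)
    (h₂ : IsLip g₂) {ω ω' : Marks} {x : ℝ × ℝ}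
    (hg : ∀ y, l1 (y - x) ≤ (2 * (l - k : ℕ) + 5) / n → g₁ y = g₂ y)
    (hω : ∀ z : ℤ × ℤ, |z.1 - n * x.1| + |z.2 - n * x.2| ≤ 2 * (l - k : ℕ) + 4 →
      ∀ s ≤ l, ω (z, s) = ω' (z, s)) :
    averagedS n k l g₁ ω x = averagedS n k l g₂ ω' x := by
  rw [averagedS_eq hn k l h₁, averagedS_eq hn k l h₂]
  congr 2
  funext u
  unfold shiftedS
  rw [discreteS_congr hn (h₁.sub_const _) (h₂.sub_const _) (fun y hy => by rw [hg y hy]) hω]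

theorem abs_averagedS_succ_right_sub_le {n : ℕ} (hn : 0 < n) (k l : ℕ) {g : ℝ × ℝ → ℝ}
    (hg : IsLip g) (ω : Marks) (x : ℝ × ℝ) :
    |averagedS n k (l + 1) g ω x - averagedS n k l g ω x| ≤ 12 / n := by
  rw [averagedS_eq hn _ _ hg, averagedS_eq hn _ _ hg]
  refine abs_average_sub_le (intervalIntegrable_shiftedS hn _ _ hg ω x _ _)
    (intervalIntegrable_shiftedS hn _ _ hg ω x _ _) fun u _ _ => ?_
  unfold shiftedS
  rw [add_sub_add_right_eq_sub]
  exact abs_discreteS_succ_right_sub_le hn k l (hg.sub_const _) ω x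

theorem abs_averagedS_succ_left_sub_le {n : ℕ} (hn : 0 < n) (k l : ℕ) {g : ℝ × ℝ → ℝ}
    (hg : IsLip g) (ω : Marks) (x : ℝ × ℝ) :
    |averagedS n (k + 1) l g ω x - averagedS n k l g ω x| ≤ 12 / n := by
  rw [averagedS_eq hn _ _ hg, averagedS_eq hn _ _ hg]
  refine abs_average_sub_le (intervalIntegrable_shiftedS hn _ _ hg ω x _ _)
    (intervalIntegrable_shiftedS hn _ _ hg ω x _ _) fun u _ _ => ?_
  unfold shiftedS
  rw [add_sub_add_right_eq_sub]
  exact abs_discreteS_succ_left_sub_le hn k l (hg.sub_const _) ω x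

theorem abs_averagedS_zero_sub_le {n : ℕ} (hn : 0 < n) (k l : ℕ) {g : ℝ × ℝ → ℝ} (hg : IsLip g)
    (ω : Marks) : |averagedS n k l g ω (0, 0) - g (0, 0)| ≤ (4 + 4 * (l - k : ℕ)) / n := by
  rw [averagedS_eq hn _ _ hg]
  refine abs_average_sub_const_le (intervalIntegrable_shiftedS hn _ _ hg ω _ _ _) fun u _ _ => ?_
  have := abs_discreteS_zero_sub_le hn k l (hg.sub_const (u / n)) ω
  unfold shiftedS
  convert this using 2
  ring

/-- Averaging over the rounding changes the discrete evolution by at most `4 / n`. -/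
theorem abs_averagedS_sub_discreteS_le {n : ℕ} (hn : 0 < n) (k l : ℕ) {g : ℝ × ℝ → ℝ}
    (hg : IsLip g) (ω : Marks) (x : ℝ × ℝ) :
    |averagedS n k l g ω x - discreteS n k l g ω x| ≤ 4 / n := by
  have hn' : (0 : ℝ) < n := Nat.cast_pos.2 hn
  rw [averagedS_eq hn _ _ hg]
  refine abs_average_sub_const_le (intervalIntegrable_shiftedS hn _ _ hg ω _ _ _) fun u h0 h4 => ?_
  have h1 := discreteS_add hn k l hg ω (-1) x
  have e0 : 0 ≤ u / n := div_nonneg h0 hn'.le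
  have e4 : u / n ≤ 4 / n := (div_le_div_iff_of_pos_right hn').2 h4
  have h2 := discreteS_mono hn k l (hg.add_const (4 * ((-1 : ℤ) : ℝ) / n)) (hg.sub_const (u / n))
    (fun y => by push_cast; rw [mul_neg, mul_one, neg_div]; linarith) ω x
  have h3 := discreteS_mono hn k l (hg.sub_const (u / n)) hg (fun y => by linarith) ω x
  rw [h1] at h2
  push_cast at h2
  rw [mul_neg, mul_one, neg_div] at h2
  unfold shiftedS
  rw [abs_le]
  constructor <;> linarith

/-! ### Interpolation in time -/

/-- Linear interpolation of a sequence at a real time `τ ≥ 0`. -/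
def linInterp (a : ℕ → ℝ) (τ : ℝ) : ℝ := a ⌊τ⌋₊ + (a (⌊τ⌋₊ + 1) - a ⌊τ⌋₊) * (τ - ⌊τ⌋₊)

theorem linInterp_mono {a b : ℕ → ℝ} {τ : ℝ} (hτ : 0 ≤ τ)
    (h : ∀ k, ⌊τ⌋₊ ≤ k → k ≤ ⌊τ⌋₊ + 1 → a k ≤ b k) : linInterp a τ ≤ linInterp b τ := by
  have h0 := h ⌊τ⌋₊ le_rfl (Nat.le_succ _)
  have h1 := h (⌊τ⌋₊ + 1) (Nat.le_succ _) le_rfl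
  have f0 := Nat.floor_le hτ
  have f1 := Nat.lt_floor_add_one τ
  unfold linInterp
  nlinarith [mul_nonneg (sub_nonneg.2 h0) (by linarith : 0 ≤ 1 - (τ - ⌊τ⌋₊)),
    mul_nonneg (sub_nonneg.2 h1) (sub_nonneg.2 f0)]

theorem linInterp_add_const (a : ℕ → ℝ) (c τ : ℝ) :
    linInterp (fun k => a k + c) τ = linInterp a τ + c := by
  unfold linInterp
  ring

theorem linInterp_const (c τ : ℝ) : linInterp (fun _ => c) τ = c := by
  unfold linInterp
  ring

theorem abs_linInterp_sub_le {a b : ℕ → ℝ} {τ c : ℝ} (hτ : 0 ≤ τ)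
    (h : ∀ k, ⌊τ⌋₊ ≤ k → k ≤ ⌊τ⌋₊ + 1 → |a k - b k| ≤ c) :
    |linInterp a τ - linInterp b τ| ≤ c := by
  have h1 := linInterp_mono (a := a) (b := fun k => b k + c) hτ
    fun k hk hk' => by have := (abs_le.1 (h k hk hk')).2; linarith
  have h2 := linInterp_mono (a := b) (b := fun k => a k + c) hτ
    fun k hk hk' => by have := (abs_le.1 (h k hk hk')).1; linarith
  rw [linInterp_add_const] at h1 h2
  rw [abs_le]
  constructor <;> linarith

theorem abs_linInterp_sub_const_le {a : ℕ → ℝ} {τ c v : ℝ} (hτ : 0 ≤ τ)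
    (h : ∀ k, ⌊τ⌋₊ ≤ k → k ≤ ⌊τ⌋₊ + 1 → |a k - v| ≤ c) : |linInterp a τ - v| ≤ c := by
  have := abs_linInterp_sub_le (b := fun _ => v) hτ h
  rwa [linInterp_const] at this

theorem abs_sub_le_of_steps {a : ℕ → ℝ} {c : ℝ} (h : ∀ k, |a (k + 1) - a k| ≤ c) (k d : ℕ) :
    |a (k + d) - a k| ≤ c * d := by
  induction d with
  | zero => simp
  | succ d ih =>
    have h1 := abs_sub_le (a (k + (d + 1))) (a (k + d)) (a k)
    have h2 := h (k + d)
    rw [← add_assoc] at h1 ⊢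
    push_cast
    linarith

theorem linInterp_lip {a : ℕ → ℝ} {c : ℝ} (h : ∀ k, |a (k + 1) - a k| ≤ c) {τ τ' : ℝ}
    (hτ : 0 ≤ τ) (hτ' : 0 ≤ τ') : |linInterp a τ - linInterp a τ'| ≤ c * |τ - τ'| := by
  wlog hle : τ ≤ τ' generalizing τ τ'
  · rw [abs_sub_comm, abs_sub_comm τ]
    exact this hτ' hτ (le_of_not_ge hle)
  have f0 := Nat.floor_le hτ
  have f1 := Nat.lt_floor_add_one τ
  have g0 := Nat.floor_le hτ'
  have g1 := Nat.lt_floor_add_one τ'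
  have hk := abs_le.1 (h ⌊τ⌋₊)
  have hl := abs_le.1 (h ⌊τ'⌋₊)
  rw [abs_sub_comm τ, abs_of_nonneg (sub_nonneg.2 hle), abs_sub_comm, abs_le]
  rcases (Nat.floor_mono hle).eq_or_lt with e | hlt
  · unfold linInterp
    rw [← e] at g0 g1 ⊢
    constructor <;> nlinarith
  · obtain ⟨d, hd⟩ := Nat.exists_eq_add_of_le (Nat.succ_le_of_lt hlt)
    have hs := abs_le.1 (abs_sub_le_of_steps h (⌊τ⌋₊ + 1) d)
    rw [Nat.succ_eq_add_one] at hd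
    rw [← hd] at hs
    have hd' : (⌊τ'⌋₊ : ℝ) = ⌊τ⌋₊ + 1 + d := by exact_mod_cast hd
    unfold linInterp
    have e1 : 0 ≤ ⌊τ⌋₊ + 1 - τ := by linarith
    have e2 : 0 ≤ τ' - ⌊τ'⌋₊ := by linarith
    have p1 := mul_le_mul_of_nonneg_right hk.1 e1
    have p2 := mul_le_mul_of_nonneg_right hk.2 e1
    have p3 := mul_le_mul_of_nonneg_right hl.1 e2
    have p4 := mul_le_mul_of_nonneg_right hl.2 e2
    have e3 : c * (τ' - τ) = c * (⌊τ⌋₊ + 1 - τ) + c * d + c * (τ' - ⌊τ'⌋₊) := by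
      rw [hd']
      ring
    constructor <;> nlinarith

/-- Bilinear interpolation is linear interpolation in each of the two times. -/
theorem hatS_eq (n : ℕ) (s t : ℝ) (g : ℝ × ℝ → ℝ) (ω : Marks) (x : ℝ × ℝ) :
    hatS n s t g ω x =
      linInterp (fun k => linInterp (fun l => averagedS n k l g ω x) (n * t)) (n * s) := by
  unfold hatS linInterp
  ring

theorem abs_hatS_sub_le {n : ℕ} {s t c : ℝ} (hs : 0 ≤ s) (ht : 0 ≤ t) {g g' : ℝ × ℝ → ℝ}
    {ω ω' : Marks} {x x' : ℝ × ℝ}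
    (h : ∀ k l : ℕ, ⌊n * s⌋₊ ≤ k → l ≤ ⌊n * t⌋₊ + 1 →
      |averagedS n k l g ω x - averagedS n k l g' ω' x'| ≤ c) :
    |hatS n s t g ω x - hatS n s t g' ω' x'| ≤ c := by
  rw [hatS_eq, hatS_eq]
  exact abs_linInterp_sub_le (by positivity) fun k hk _ =>
    abs_linInterp_sub_le (by positivity) fun l _ hl => h k l hk hl

theorem abs_hatS_sub_const_le {n : ℕ} {s t c v : ℝ} (hs : 0 ≤ s) (ht : 0 ≤ t) {g : ℝ × ℝ → ℝ}
    {ω : Marks} {x : ℝ × ℝ}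
    (h : ∀ k l : ℕ, ⌊n * s⌋₊ ≤ k → k ≤ ⌊n * s⌋₊ + 1 → ⌊n * t⌋₊ ≤ l → l ≤ ⌊n * t⌋₊ + 1 →
      |averagedS n k l g ω x - v| ≤ c) :
    |hatS n s t g ω x - v| ≤ c := by
  rw [hatS_eq]
  exact abs_linInterp_sub_const_le (by positivity) fun k hk hk' =>
    abs_linInterp_sub_const_le (by positivity) fun l hl hl' => h k l hk hk' hl hl'

theorem isLip_hatS {n : ℕ} (hn : 0 < n) {s t : ℝ} (hs : 0 ≤ s) (ht : 0 ≤ t) {g : ℝ × ℝ → ℝ}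
    (hg : IsLip g) (ω : Marks) : IsLip (hatS n s t g ω) := fun x y =>
  abs_hatS_sub_le hs ht fun k l _ _ => isLip_averagedS hn k l hg ω x y

theorem hatS_mono {n : ℕ} (hn : 0 < n) {s t : ℝ} (hs : 0 ≤ s) (ht : 0 ≤ t) {g₁ g₂ : ℝ × ℝ → ℝ}
    (h₁ : IsLip g₁) (h₂ : IsLip g₂) (h : ∀ x, g₁ x ≤ g₂ x) (ω : Marks) (x : ℝ × ℝ) :
    hatS n s t g₁ ω x ≤ hatS n s t g₂ ω x := by
  rw [hatS_eq, hatS_eq]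
  exact linInterp_mono (by positivity) fun k _ _ => linInterp_mono (by positivity) fun l _ _ =>
    averagedS_mono hn k l h₁ h₂ h ω x

theorem hatS_add (n : ℕ) (s t : ℝ) (g : ℝ × ℝ → ℝ) (ω : Marks) (m : ℝ) (x : ℝ × ℝ) :
    hatS n s t (fun y => g y + m) ω x = hatS n s t g ω x + m := by
  simp only [hatS_eq, averagedS_add, linInterp_add_const]

/-- Finite range of dependence of the interpolated evolution; `d` bounds the number of
shuffles. -/
theorem hatS_congr {n : ℕ} (hn : 0 < n) {s t : ℝ} (hs : 0 ≤ s) (ht : 0 ≤ t) {d : ℕ}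
    (hd : ⌊n * t⌋₊ + 1 - ⌊n * s⌋₊ ≤ d) {g₁ g₂ : ℝ × ℝ → ℝ} (h₁ : IsLip g₁)
    (h₂ : IsLip g₂) {ω ω' : Marks} {x : ℝ × ℝ}
    (hg : ∀ y, l1 (y - x) ≤ (2 * d + 5) / n → g₁ y = g₂ y)
    (hω : ∀ z : ℤ × ℤ, |z.1 - n * x.1| + |z.2 - n * x.2| ≤ 2 * d + 4 →
      ∀ i ≤ ⌊n * t⌋₊ + 1, ω (z, i) = ω' (z, i)) :
    hatS n s t g₁ ω x = hatS n s t g₂ ω' x := by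
  refine sub_eq_zero.1 (abs_nonpos_iff.1 (abs_hatS_sub_le hs ht fun k l hk hl => ?_))
  have hkl : ((l - k : ℕ) : ℝ) ≤ d := Nat.cast_le.2 (by omega)
  rw [averagedS_congr hn h₁ h₂ (fun y hy => hg y (hy.trans (by gcongr)))
    (fun z hz i hi => hω z (hz.trans (by gcongr)) i (hi.trans hl)), sub_self, abs_zero]

theorem abs_hatS_time_sub_le {n : ℕ} (hn : 0 < n) {s t s' t' : ℝ} (hs : 0 ≤ s) (ht : 0 ≤ t)
    (hs' : 0 ≤ s') (ht' : 0 ≤ t') {g : ℝ × ℝ → ℝ} (hg : IsLip g) (ω : Marks) (x : ℝ × ℝ) :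
    |hatS n s t g ω x - hatS n s' t' g ω x| ≤ 12 * (|s - s'| + |t - t'|) := by
  have hn' : (0 : ℝ) < n := Nat.cast_pos.2 hn
  have scale : ∀ a b : ℝ, 12 / (n : ℝ) * |n * a - n * b| = 12 * |a - b| := by
    intro a b
    rw [← mul_sub, abs_mul, abs_of_pos hn']
    field_simp
  have h1 : |hatS n s t g ω x - hatS n s' t g ω x| ≤ 12 * |s - s'| := by
    rw [hatS_eq, hatS_eq, ← scale]
    exact linInterp_lip (fun k => abs_linInterp_sub_le (by positivity) fun l _ _ =>
      abs_averagedS_succ_left_sub_le hn k l hg ω x) (by positivity) (by positivity)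
  have h2 : |hatS n s' t g ω x - hatS n s' t' g ω x| ≤ 12 * |t - t'| := by
    rw [hatS_eq, hatS_eq, ← scale]
    exact abs_linInterp_sub_le (by positivity) fun k _ _ =>
      linInterp_lip (fun l => abs_averagedS_succ_right_sub_le hn k l hg ω x) (by positivity)
        (by positivity)
  have := abs_sub_le (hatS n s t g ω x) (hatS n s' t g ω x) (hatS n s' t' g ω x)
  linarith

theorem abs_hatS_zero_sub_le {n : ℕ} (hn : 0 < n) {s t T : ℝ} (hs : 0 ≤ s) (ht : 0 ≤ t)
    (htT : t ≤ T) {g : ℝ × ℝ → ℝ} (hg : IsLip g) (ω : Marks) :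
    |hatS n s t g ω (0, 0) - g (0, 0)| ≤ 8 + 4 * T := by
  have hn1 : (1 : ℝ) ≤ n := Nat.one_le_cast.2 hn
  refine abs_hatS_sub_const_le hs ht fun k l _ _ _ hl => ?_
  refine (abs_averagedS_zero_sub_le hn k l hg ω).trans ?_
  have h1 : ((l - k : ℕ) : ℝ) ≤ ⌊n * t⌋₊ + 1 := by exact_mod_cast (l.sub_le k).trans hl
  have h2 := Nat.floor_le (by positivity : 0 ≤ (n : ℝ) * t)
  have h3 : (n : ℝ) * t ≤ n * T := by gcongr
  rw [div_le_iff₀ (by linarith)]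
  linarith

/-- For `t ≤ s` the evolution is nearly the identity. -/
theorem abs_hatS_sub_self_le {n : ℕ} (hn : 0 < n) {s t : ℝ} (ht : 0 ≤ t)
    (hts : t ≤ s) {g : ℝ × ℝ → ℝ} (hg : IsLip g) (ω : Marks) (x : ℝ × ℝ) :
    |hatS n s t g ω x - g x| ≤ 12 / n := by
  refine abs_hatS_sub_const_le (ht.trans hts) ht fun k l hk _ _ hl => ?_
  have hfl : ⌊n * t⌋₊ ≤ ⌊n * s⌋₊ := Nat.floor_mono (by gcongr)
  rcases le_or_gt l k with h | h
  · rw [averagedS_of_le hn h hg, sub_self, abs_zero]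
    positivity
  · obtain rfl : l = k + 1 := by omega
    have := abs_averagedS_succ_right_sub_le hn k k hg ω x
    rwa [averagedS_of_le hn (le_refl k) hg] at this

theorem abs_hatS_sub_averagedS_le {n : ℕ} (hn : 0 < n) {s t : ℝ} (hs : 0 ≤ s) (ht : 0 ≤ t)
    {g : ℝ × ℝ → ℝ} (hg : IsLip g) (ω : Marks) (x : ℝ × ℝ) :
    |hatS n s t g ω x - averagedS n ⌊n * s⌋₊ ⌊n * t⌋₊ g ω x| ≤ 24 / n := by
  have hpos : (0 : ℝ) ≤ 12 / n := by positivity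
  have h24 : (24 : ℝ) / n = 12 / n + 12 / n := by ring
  refine abs_hatS_sub_const_le hs ht fun k l hk hk' hl hl' => ?_
  have h1 : |averagedS n k l g ω x - averagedS n ⌊n * s⌋₊ l g ω x| ≤ 12 / n := by
    obtain rfl | rfl : k = ⌊n * s⌋₊ ∨ k = ⌊n * s⌋₊ + 1 := by omega
    · simpa using hpos
    · exact abs_averagedS_succ_left_sub_le hn _ l hg ω x
  have h2 : |averagedS n ⌊n * s⌋₊ l g ω x - averagedS n ⌊n * s⌋₊ ⌊n * t⌋₊ g ω x| ≤ 12 / n := by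
    obtain rfl | rfl : l = ⌊n * t⌋₊ ∨ l = ⌊n * t⌋₊ + 1 := by omega
    · simpa using hpos
    · exact abs_averagedS_succ_right_sub_le hn _ _ hg ω x
  have := abs_sub_le (averagedS n k l g ω x) (averagedS n ⌊n * s⌋₊ l g ω x)
    (averagedS n ⌊n * s⌋₊ ⌊n * t⌋₊ g ω x)
  linarith

/-- A monotone map that commutes with constants is nonexpansive for the uniform distance. -/
theorem abs_sub_le_of_mono_add {F : (ℝ × ℝ → ℝ) → ℝ} {c : ℝ} {g₁ g₂ : ℝ × ℝ → ℝ}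
    (hmono : ∀ g₁ g₂, IsLip g₁ → IsLip g₂ → (∀ x, g₁ x ≤ g₂ x) → F g₁ ≤ F g₂)
    (hadd : ∀ (g : ℝ × ℝ → ℝ) (m : ℝ), F (fun x => g x + m) = F g + m)
    (h₁ : IsLip g₁) (h₂ : IsLip g₂) (h : ∀ x, |g₁ x - g₂ x| ≤ c) : |F g₁ - F g₂| ≤ c := by
  have e1 := hmono _ _ h₁ (h₂.add_const c) fun x => by have := (abs_le.1 (h x)).2; linarith
  have e2 := hmono _ _ h₂ (h₁.add_const c) fun x => by have := (abs_le.1 (h x)).1; linarith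
  rw [hadd] at e1 e2
  rw [abs_le]
  constructor <;> linarith

theorem abs_averagedS_sub_averagedS_le {n : ℕ} (hn : 0 < n) (k l : ℕ) {c : ℝ}
    {g₁ g₂ : ℝ × ℝ → ℝ} (h₁ : IsLip g₁) (h₂ : IsLip g₂) (h : ∀ x, |g₁ x - g₂ x| ≤ c) (ω : Marks)
    (x : ℝ × ℝ) : |averagedS n k l g₁ ω x - averagedS n k l g₂ ω x| ≤ c :=
  abs_sub_le_of_mono_add (F := fun g => averagedS n k l g ω x)
    (fun _ _ a b h => averagedS_mono hn k l a b h ω x)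
    (fun g m => averagedS_add n k l g ω m x) h₁ h₂ h

/-- The semigroup property holds up to an error of order `1 / n`. -/
theorem abs_hatS_hatS_sub_le {n : ℕ} (hn : 0 < n) {t₁ t₂ t₃ : ℝ} (h1 : 0 ≤ t₁) (h12 : t₁ ≤ t₂)
    (h23 : t₂ ≤ t₃) {g : ℝ × ℝ → ℝ} (hg : IsLip g) (ω : Marks) (x : ℝ × ℝ) :
    |hatS n t₂ t₃ (hatS n t₁ t₂ g ω) ω x - hatS n t₁ t₃ g ω x| ≤ 96 / n := by
  have h2 := h1.trans h12
  have h3 := h2.trans h23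
  set k := ⌊n * t₁⌋₊
  set l := ⌊n * t₂⌋₊
  set m := ⌊n * t₃⌋₊
  have hkl : k ≤ l := Nat.floor_mono (by gcongr)
  have hlm : l ≤ m := Nat.floor_mono (by gcongr)
  have hH := isLip_hatS hn h1 h2 hg ω
  have hD := isLip_discreteS hn k l hg ω
  have e1 := abs_hatS_sub_averagedS_le hn h2 h3 hH ω x
  have near : ∀ y, |hatS n t₁ t₂ g ω y - discreteS n k l g ω y| ≤ 28 / n := by
    intro y
    have a1 := abs_hatS_sub_averagedS_le hn h1 h2 hg ω y
    have a2 := abs_averagedS_sub_discreteS_le hn k l hg ω y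
    have a3 : (28 : ℝ) / n = 24 / n + 4 / n := by ring
    have := abs_sub_le (hatS n t₁ t₂ g ω y) (averagedS n k l g ω y) (discreteS n k l g ω y)
    linarith
  have e2 := abs_averagedS_sub_averagedS_le hn l m hH hD near ω x
  have e3 := abs_averagedS_sub_discreteS_le hn l m hD ω x
  have e4 := abs_discreteS_discreteS_sub_le hn hkl hlm hg ω x
  have e5 := abs_averagedS_sub_discreteS_le hn k m hg ω x
  have e6 := abs_hatS_sub_averagedS_le hn h1 h3 hg ω x
  have e7 : (96 : ℝ) / n = 24 / n + 28 / n + 4 / n + 12 / n + 4 / n + 24 / n := by ring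
  rw [abs_le] at *
  constructor <;> linarith

/-! ### The random evolution -/

theorem one_le_of_isInterpBound {C₀ : ℝ} (h : IsInterpBound C₀) : 1 ≤ C₀ := by
  have := h pyramidFormula isAdmissible_pyramidFormula (0, 1)
  norm_num [interp, pyramidFormula, squareInterp, Int.even_iff] at this
  linarith

/-- The evolution at two given times as an element of `E^r_q`. -/
def hatEvol {T C₀ : ℝ} (hC₀ : IsInterpBound C₀) {n : ℕ} (hn : 0 < n) (ω : Marks)
    (p : Set.Icc (0 : ℝ) T × Set.Icc (0 : ℝ) T) : Evol (10 + C₀ + 4 * T) (2 * T + 9) where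
  toFun g := ⟨hatS n p.1 p.2 g ω, isLip_hatS hn p.1.2.1 p.2.2.1 g.2 ω⟩
  add_const' g g' m h x := by
    have : g'.1 = fun x => g x + m := funext h
    simp only [this, hatS_add]
  mono' g₁ g₂ h x := hatS_mono hn p.1.2.1 p.2.2.1 g₁.2 g₂.2 h ω x
  bound' g := by
    have h1 := abs_hatS_zero_sub_le hn p.1.2.1 p.2.2.1 p.2.2.2 g.2 ω
    have h2 := one_le_of_isInterpBound hC₀
    exact h1.trans (by linarith)
  local' g₁ g₂ R _ h x hx := by
    refine hatS_congr hn p.1.2.1 p.2.2.1 (Nat.sub_le _ _) g₁.2 g₂.2 (fun y hy => h y ?_)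
      fun _ _ _ _ => rfl
    have hn1 : (1 : ℝ) ≤ n := Nat.one_le_cast.2 hn
    have h1 : (n : ℝ) * p.2 ≤ n * T := by gcongr; exact p.2.2.2
    have h2 := Nat.floor_le (mul_nonneg n.cast_nonneg p.2.2.1 : 0 ≤ (n : ℝ) * p.2)
    have h3 : (2 * ((⌊n * (p.2 : ℝ)⌋₊ + 1 : ℕ) : ℝ) + 5) / n ≤ 2 * T + 9 := by
      rw [div_le_iff₀ (by linarith)]
      push_cast
      linarith
    have t1 := abs_sub_abs_le_abs_sub y.1 x.1
    have t2 := abs_sub_abs_le_abs_sub y.2 x.2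
    simp only [l1, Prod.fst_sub, Prod.snd_sub] at *
    linarith

theorem hasSum_half_pow (N : ℕ) : HasSum (fun i : ℕ => (1 / 2 : ℝ) ^ (i + N + 1)) ((1 / 2) ^ N) := by
  have := (hasSum_geometric_two).mul_left ((1 / 2 : ℝ) ^ (N + 1))
  rw [pow_succ, mul_assoc, one_div_mul_cancel two_ne_zero, mul_one] at this
  refine this.congr_fun fun i => ?_
  ring

theorem evolDist_le {r q c : ℝ} {F₁ F₂ : Evol r q}
    (h : ∀ (g : Asymp) (x : ℝ × ℝ), |F₁ g x - F₂ g x| ≤ c) : dist F₁ F₂ ≤ c := by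
  have hs := (hasSum_half_pow 0).mul_right c
  rw [pow_zero, one_mul] at hs
  refine hasSum_le (fun i => ?_) (evolDist_summable F₁ F₂).hasSum hs
  have h0 := evolSup_nonneg F₁ F₂ (i + 1)
  refine mul_le_mul_of_nonneg_left ?_ (by positivity)
  exact (div_le_self h0 (by linarith)).trans (evolSup_le _ _ _ _ fun g x _ => h g x)

theorem evolDist_le_pow {r q : ℝ} {F₁ F₂ : Evol r q} {N : ℕ}
    (h : ∀ (g : Asymp) (x : ℝ × ℝ), l1 x ≤ N → F₁ g x = F₂ g x) : dist F₁ F₂ ≤ (1 / 2) ^ N := by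
  have hsum := evolDist_summable F₁ F₂
  change evolDist F₁ F₂ ≤ _
  unfold evolDist
  rw [← hsum.sum_add_tsum_nat_add N, Finset.sum_eq_zero, zero_add]
  · refine hasSum_le (fun i => ?_) ((summable_nat_add_iff N).2 hsum).hasSum (hasSum_half_pow N)
    exact mul_le_of_le_one_right (by positivity) (frac_le_one (evolSup_nonneg F₁ F₂ _))
  · intro i hi
    have hi' : ((i + 1 : ℕ) : ℝ) ≤ N := Nat.cast_le.2 (Finset.mem_range.1 hi)
    have : evolSup (i + 1) F₁ F₂ = 0 := le_antisymm
      (evolSup_le _ _ _ _ fun g x hx => by rw [h g x (hx.trans hi'), sub_self, abs_zero])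
      (evolSup_nonneg _ _ _)
    rw [this, zero_div, mul_zero]

theorem dist_hatEvol_le {T C₀ : ℝ} (hC₀ : IsInterpBound C₀) {n : ℕ} (hn : 0 < n) (ω : Marks)
    (s t s' t' : Set.Icc (0 : ℝ) T) :
    dist (hatEvol hC₀ hn ω (s, t)) (hatEvol hC₀ hn ω (s', t')) ≤
      12 * (|(s : ℝ) - s'| + |(t : ℝ) - t'|) :=
  evolDist_le fun g x =>
    abs_hatS_time_sub_le hn s.2.1 t.2.1 s'.2.1 t'.2.1 g.2 ω x

/-- The evolution as an element of `C_T`. -/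
def hatCT {T C₀ : ℝ} (hC₀ : IsInterpBound C₀) {n : ℕ} (hn : 0 < n) (ω : Marks) : CT T C₀ where
  toFun := hatEvol hC₀ hn ω
  continuous_toFun := by
    refine (LipschitzWith.of_dist_le_mul (K := 24) fun p p' => ?_).continuous
    refine (dist_hatEvol_le hC₀ hn ω p.1 p.2 p'.1 p'.2).trans ?_
    have h1 : |(p.1 : ℝ) - p'.1| ≤ dist p p' := le_max_left (dist p.1 p'.1) (dist p.2 p'.2)
    have h2 : |(p.2 : ℝ) - p'.2| ≤ dist p p' := le_max_right (dist p.1 p'.1) (dist p.2 p'.2)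
    push_cast
    linarith

theorem hatCT_mem_CTLip {T C₀ : ℝ} (hC₀ : IsInterpBound C₀) {n : ℕ} (hn : 0 < n) (ω : Marks) :
    (hatCT hC₀ hn ω : CT T C₀) ∈ CTLip T C₀ := by
  intro s t s' t'
  refine (dist_hatEvol_le hC₀ hn ω s t s' t').trans ?_
  have := one_le_of_isInterpBound hC₀
  gcongr
  linarith

/-- The evolution depends continuously on the marks: on a ball it is determined by finitely many
of them. -/
theorem continuous_hatCT {T C₀ : ℝ} (hC₀ : IsInterpBound C₀) {n : ℕ} (hn : 0 < n) :
    Continuous (hatCT hC₀ hn : Marks → CT T C₀) := by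
  rw [continuous_iff_continuousAt]
  intro ω
  rw [ContinuousAt, Metric.tendsto_nhds]
  intro ε hε
  obtain ⟨N, hN⟩ := exists_pow_lt_of_lt_one hε (by norm_num : (1 / 2 : ℝ) < 1)
  set d : ℕ := ⌊n * T⌋₊ + 1 with hd
  set M : ℤ := n * N + 2 * d + 4 with hM
  set A : Finset ((ℤ × ℤ) × ℕ) :=
    (Finset.Icc (-M) M ×ˢ Finset.Icc (-M) M) ×ˢ Finset.range (d + 1) with hA
  have hev : ∀ᶠ ω' in 𝓝 ω, ∀ p ∈ A, ω' p = ω p := by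
    rw [Filter.eventually_all_finset]
    intro p _
    have hc : Continuous fun ω' : Marks => ω' p := continuous_apply p
    have : IsOpen {ω' : Marks | ω' p = ω p} := (isOpen_discrete ({ω p} : Set Bool)).preimage hc
    exact this.mem_nhds rfl
  filter_upwards [hev] with ω' hω'
  refine lt_of_le_of_lt ((ContinuousMap.dist_le (by positivity)).2 fun p => ?_) hN
  refine evolDist_le_pow fun g x hx => ?_
  have hfl : ⌊n * (p.2 : ℝ)⌋₊ + 1 ≤ d :=
    Nat.succ_le_succ (Nat.floor_mono (by gcongr; exact p.2.2.2))
  refine hatS_congr hn p.1.2.1 p.2.2.1 ((Nat.sub_le _ _).trans hfl) g.2 g.2 (fun _ _ => rfl) ?_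
  intro z hz i hi
  have hn' : (0 : ℝ) ≤ n := n.cast_nonneg
  have hx1 : (n : ℝ) * |x.1| + n * |x.2| ≤ n * N := by
    rw [← mul_add]
    exact mul_le_mul_of_nonneg_left hx hn'
  have a1 := abs_sub_abs_le_abs_sub (z.1 : ℝ) (n * x.1)
  have a2 := abs_sub_abs_le_abs_sub (z.2 : ℝ) (n * x.2)
  rw [abs_mul, abs_of_nonneg hn'] at a1 a2
  have p1 := mul_nonneg hn' (abs_nonneg x.1)
  have p2 := mul_nonneg hn' (abs_nonneg x.2)
  have b1 : |(z.1 : ℝ)| ≤ M := by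
    rw [hM]
    push_cast
    have := abs_nonneg ((z.2 : ℝ) - n * x.2)
    linarith
  have b2 : |(z.2 : ℝ)| ≤ M := by
    rw [hM]
    push_cast
    have := abs_nonneg ((z.1 : ℝ) - n * x.1)
    linarith
  have c1 : |z.1| ≤ M := by exact_mod_cast b1
  have c2 : |z.2| ≤ M := by exact_mod_cast b2
  refine hω' _ ?_
  rw [abs_le] at c1 c2
  simp only [hA, Finset.mem_product, Finset.mem_Icc, Finset.mem_range]
  exact ⟨⟨c1, c2⟩, by omega⟩

/-- The random element `Ŝ_n` of `C_T`; for `n = 0`, where the rescaling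
makes no sense, it is set to `Ŝ_1`. -/
def randomEvol {T C₀ : ℝ} (hC₀ : IsInterpBound C₀) (n : ℕ) (ω : Marks) : CT T C₀ :=
  hatCT hC₀ (lt_max_of_lt_right one_pos : 0 < max n 1) ω

theorem randomEvol_of_pos {T C₀ : ℝ} (hC₀ : IsInterpBound C₀) {n : ℕ} (hn : 0 < n) :
    (randomEvol hC₀ n : Marks → CT T C₀) = hatCT hC₀ hn := by
  unfold randomEvol
  congr! 3
  exact max_eq_left hn

theorem measurable_randomEvol {T C₀ : ℝ} (hC₀ : IsInterpBound C₀) (n : ℕ) :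
    Measurable (randomEvol hC₀ n : Marks → CT T C₀) :=
  (continuous_hatCT hC₀ _).measurable

/-! ### Continuity of evolutions in the profile -/

theorem IsLip.max {g₁ g₂ : ℝ × ℝ → ℝ} (h₁ : IsLip g₁) (h₂ : IsLip g₂) :
    IsLip fun x => max (g₁ x) (g₂ x) := fun x y =>
  (abs_max_sub_max_le_max _ _ _ _).trans (max_le (h₁ x y) (h₂ x y))

theorem IsLip.min {g₁ g₂ : ℝ × ℝ → ℝ} (h₁ : IsLip g₁) (h₂ : IsLip g₂) :
    IsLip fun x => min (g₁ x) (g₂ x) := fun x y =>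
  (abs_min_sub_min_le_max _ _ _ _).trans (max_le (h₁ x y) (h₂ x y))

theorem l1_nonneg (x : ℝ × ℝ) : 0 ≤ l1 x := by
  unfold l1
  positivity

theorem l1_add_le (x y : ℝ × ℝ) : l1 (x + y) ≤ l1 x + l1 y := by
  have h1 := abs_add_le x.1 y.1
  have h2 := abs_add_le x.2 y.2
  simp only [l1, Prod.fst_add, Prod.snd_add]
  linarith

theorem l1_smul (c : ℝ) (x : ℝ × ℝ) : l1 (c • x) = |c| * l1 x := by
  simp only [l1, Prod.smul_fst, Prod.smul_snd, smul_eq_mul, abs_mul, mul_add]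

theorem IsLip.abs_sub_le_l1 {g : ℝ × ℝ → ℝ} (hg : IsLip g) (x y : ℝ × ℝ) :
    |g x - g y| ≤ 2 * l1 (x - y) := by
  refine (hg x y).trans (mul_le_mul_of_nonneg_left ?_ zero_le_two)
  exact max_le (le_add_of_nonneg_right (abs_nonneg _)) (le_add_of_nonneg_left (abs_nonneg _))

theorem Evol.abs_sub_le {r q c : ℝ} (F : Evol r q) {g₁ g₂ : Asymp} (h : ∀ x, |g₁ x - g₂ x| ≤ c)
    (x : ℝ × ℝ) : |F g₁ x - F g₂ x| ≤ c := by
  have a1 := F.add_const' g₂ ⟨_, IsLip.add_const g₂.2 c⟩ c (fun _ => rfl) x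
  have a2 := F.add_const' g₁ ⟨_, IsLip.add_const g₁.2 c⟩ c (fun _ => rfl) x
  have e1 := F.mono' g₁ ⟨_, IsLip.add_const g₂.2 c⟩
    (fun y => by have := (abs_le.1 (h y)).2; simp only; linarith) x
  have e2 := F.mono' g₂ ⟨_, IsLip.add_const g₁.2 c⟩
    (fun y => by have := (abs_le.1 (h y)).1; simp only; linarith) x
  rw [abs_le]
  constructor <;> linarith

/-- If `F(g)(x)` depends only on `g` in the `ℓ¹` ball of radius `ρ` around `x`, then it is
nonexpansive for the uniform distance on that ball: outside of it, one profile may be truncated to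
be close to the other one. -/
theorem Evol.abs_sub_le_of_local {r q ρ δ : ℝ} (F : Evol r q) {x : ℝ × ℝ}
    (hF : ∀ g₁ g₂ : Asymp, (∀ y, l1 (y - x) ≤ ρ → g₁ y = g₂ y) → F g₁ x = F g₂ x) (hδ : 0 ≤ δ)
    {g₁ g₂ : Asymp} (h : ∀ y, l1 (y - x) ≤ ρ → |g₁ y - g₂ y| ≤ δ) : |F g₁ x - F g₂ x| ≤ δ := by
  set g : Asymp := ⟨fun y => max (min (g₁ y) (g₂ y + δ)) (g₂ y - δ),
    (IsLip.min g₁.2 (IsLip.add_const g₂.2 δ)).max (IsLip.sub_const g₂.2 δ)⟩ with hg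
  have h1 : F g₁ x = F g x := hF g₁ g fun y hy => by
    have := abs_le.1 (h y hy)
    simp only [hg]
    rw [min_eq_left (by linarith), max_eq_left (by linarith)]
  rw [h1]
  refine F.abs_sub_le (fun y => ?_) x
  simp only [hg]
  rw [abs_le]
  have h2 := le_max_right (min (g₁ y) (g₂ y + δ)) (g₂ y - δ)
  have h3 : max (min (g₁ y) (g₂ y + δ)) (g₂ y - δ) ≤ g₂ y + δ :=
    max_le (min_le_right _ _) (by linarith)
  constructor <;> linarith

/-- Elements of `E^r_q` are continuous for locally uniform convergence. -/
theorem Evol.abs_sub_le_of_ball {r q δ : ℝ} (F : Evol r q) {x : ℝ × ℝ} (hδ : 0 ≤ δ)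
    {g₁ g₂ : Asymp} (h : ∀ y, l1 y ≤ 3 * l1 x + |q| → |g₁ y - g₂ y| ≤ δ) :
    |F g₁ x - F g₂ x| ≤ δ := by
  refine F.abs_sub_le_of_local (ρ := 2 * l1 x + |q|) (fun f₁ f₂ hf => ?_) hδ
    fun y hy => h y ?_
  · refine F.local' f₁ f₂ (l1 x + |q|) (by linarith [le_abs_self q, l1_nonneg x])
      (fun y hy => hf y ?_) x (by linarith [le_abs_self q])
    have h1 := l1_add_le y (-x)
    have h2 : l1 (-x) = l1 x := by simp [l1]
    rw [← sub_eq_add_neg] at h1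
    linarith
  · have h1 := l1_add_le (y - x) x
    rw [sub_add_cancel] at h1
    linarith

/-! ### Convergence of evolutions -/

theorem evolSup_le_dist {r q : ℝ} (F₁ F₂ : Evol r q) (k : ℕ)
    (h : 2 ^ (k + 1) * dist F₁ F₂ ≤ 1 / 2) :
    evolSup (k + 1) F₁ F₂ ≤ 2 * (2 ^ (k + 1) * dist F₁ F₂) := by
  have h0 := evolSup_nonneg F₁ F₂ (k + 1)
  have h1 : (1 / 2 : ℝ) ^ (k + 1) * (evolSup (k + 1) F₁ F₂ / (1 + evolSup (k + 1) F₁ F₂)) ≤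
      dist F₁ F₂ :=
    (evolDist_summable F₁ F₂).le_tsum k fun i _ => evolDist_term_nonneg F₁ F₂ i
  have h2 : evolSup (k + 1) F₁ F₂ / (1 + evolSup (k + 1) F₁ F₂) ≤
      2 ^ (k + 1) * dist F₁ F₂ := by
    rw [one_div, inv_pow, inv_mul_le_iff₀ (by positivity)] at h1
    exact h1
  rw [div_le_iff₀ (by linarith)] at h2
  nlinarith

theorem tendsto_evolSup {r q : ℝ} {F : ℕ → Evol r q} {G : Evol r q}
    (h : Tendsto F atTop (𝓝 G)) (k : ℕ) :
    Tendsto (fun j => evolSup (k + 1) (F j) G) atTop (𝓝 0) := by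
  have h1 : Tendsto (fun j => 2 ^ (k + 1) * dist (F j) G) atTop (𝓝 0) := by
    simpa using (tendsto_iff_dist_tendsto_zero.1 h).const_mul ((2 : ℝ) ^ (k + 1))
  have h2 : Tendsto (fun j => 2 * (2 ^ (k + 1) * dist (F j) G)) atTop (𝓝 0) := by
    simpa using h1.const_mul 2
  refine tendsto_of_tendsto_of_tendsto_of_le_of_le' tendsto_const_nhds h2
    (Eventually.of_forall fun j => evolSup_nonneg _ _ _) ?_
  filter_upwards [h1.eventually (ge_mem_nhds (by norm_num : (0 : ℝ) < 1 / 2))] with j hj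
  exact evolSup_le_dist _ _ _ hj

theorem exists_le_nat_succ (a : ℝ) : ∃ k : ℕ, a ≤ ((k + 1 : ℕ) : ℝ) := by
  obtain ⟨k, hk⟩ := exists_nat_ge a
  exact ⟨k, hk.trans (by push_cast; linarith)⟩

/-- Evaluation is jointly continuous: if `F_j → G` and `f_j → f` uniformly on balls, then
`F_j(f_j)(x) → G(f)(x)`. -/
theorem tendsto_eval {r q : ℝ} {F : ℕ → Evol r q} {G : Evol r q}
    (h : Tendsto F atTop (𝓝 G)) {f : ℕ → Asymp} {f' : Asymp} {x : ℝ × ℝ} {δ : ℕ → ℝ}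
    (hδ : Tendsto δ atTop (𝓝 0)) (hδ0 : ∀ j, 0 ≤ δ j)
    (hf : ∀ j y, l1 y ≤ 3 * l1 x + |q| → |f j y - f' y| ≤ δ j) :
    Tendsto (fun j => F j (f j) x) atTop (𝓝 (G f' x)) := by
  obtain ⟨k, hk⟩ := exists_le_nat_succ (l1 x)
  rw [tendsto_iff_dist_tendsto_zero]
  have hb : Tendsto (fun j => evolSup (k + 1) (F j) G + δ j) atTop (𝓝 0) := by
    simpa using (tendsto_evolSup h k).add hδ
  refine squeeze_zero (fun _ => dist_nonneg) (fun j => ?_) hb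
  rw [Real.dist_eq]
  have h1 := abs_le_evolSup (F j) G (f j) (k + 1) x hk
  have h2 := G.abs_sub_le_of_ball (hδ0 j) (hf j)
  have := abs_sub_le (F j (f j) x) (G (f j) x) (G f' x)
  linarith

theorem tendsto_eval_const {r q : ℝ} {F : ℕ → Evol r q} {G : Evol r q}
    (h : Tendsto F atTop (𝓝 G)) (f : Asymp) (x : ℝ × ℝ) :
    Tendsto (fun j => F j f x) atTop (𝓝 (G f x)) :=
  tendsto_eval h (f := fun _ => f) (δ := fun _ => 0) tendsto_const_nhds (fun _ => le_rfl)
    fun j y _ => by simp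

/-! ### Limits of the discrete evolutions -/

/-- A vector of `ℓ¹` norm at most `a + b` is the sum of two vectors of norm at most `a` and `b`. -/
theorem exists_l1_split {a b : ℝ} (ha : 0 ≤ a) (hb : 0 ≤ b) {v : ℝ × ℝ} (hv : l1 v ≤ a + b) :
    ∃ w, l1 w ≤ a ∧ l1 (v - w) ≤ b := by
  rcases (add_nonneg ha hb).eq_or_lt with h0 | hpos
  · refine ⟨0, by simpa [l1] using ha, ?_⟩
    rw [sub_zero]
    linarith
  · refine ⟨(a / (a + b)) • v, ?_, ?_⟩
    · rw [l1_smul, abs_of_nonneg (by positivity)]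
      calc a / (a + b) * l1 v ≤ a / (a + b) * (a + b) := by gcongr
        _ = a := by field_simp
    · have : v - (a / (a + b)) • v = (b / (a + b)) • v := by
        nth_rewrite 1 [← one_smul ℝ v]
        rw [← sub_smul]
        congr 1
        field_simp
        ring
      rw [this, l1_smul, abs_of_nonneg (by positivity)]
      calc b / (a + b) * l1 v ≤ b / (a + b) * (a + b) := by gcongr
        _ = b := by field_simp

/-- Information propagates at speed at most `2`, up to an error of order `1 / n`. -/
theorem hatEvol_local {T C₀ : ℝ} (hC₀ : IsInterpBound C₀) {n : ℕ} (hn : 0 < n) (ω : Marks)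
    {s t : Set.Icc (0 : ℝ) T} (hst : s ≤ t) {g₁ g₂ : Asymp} {x : ℝ × ℝ}
    (h : ∀ y, l1 (y - x) ≤ 2 * ((t : ℝ) - s) + 9 / n → g₁ y = g₂ y) :
    hatEvol hC₀ hn ω (s, t) g₁ x = hatEvol hC₀ hn ω (s, t) g₂ x := by
  have hn' : (0 : ℝ) < n := Nat.cast_pos.2 hn
  refine hatS_congr hn s.2.1 t.2.1 le_rfl g₁.2 g₂.2 (fun y hy => h y (hy.trans ?_))
    fun _ _ _ _ => rfl
  have hfl : ⌊n * (s : ℝ)⌋₊ ≤ ⌊n * (t : ℝ)⌋₊ := Nat.floor_mono (by gcongr)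
  have h1 := Nat.floor_le (mul_nonneg n.cast_nonneg t.2.1 : 0 ≤ (n : ℝ) * t)
  have h2 := Nat.lt_floor_add_one ((n : ℝ) * s)
  rw [Nat.cast_sub (hfl.trans (Nat.le_succ _)), div_le_iff₀ hn', add_mul, div_mul_cancel₀ _ hn'.ne']
  push_cast
  nlinarith

theorem abs_hatEvol_sub_le {T C₀ : ℝ} (hC₀ : IsInterpBound C₀) {n : ℕ} (hn : 0 < n) (ω : Marks)
    {s t : Set.Icc (0 : ℝ) T} (hst : s ≤ t) {g₁ g₂ : Asymp} {y : ℝ × ℝ}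
    (h : ∀ z, l1 (z - y) ≤ 2 * ((t : ℝ) - s) → g₁ z = g₂ z) :
    |hatEvol hC₀ hn ω (s, t) g₁ y - hatEvol hC₀ hn ω (s, t) g₂ y| ≤ 36 / n := by
  have hts : (0 : ℝ) ≤ 2 * ((t : ℝ) - s) := mul_nonneg zero_le_two (sub_nonneg.2 hst)
  refine (hatEvol hC₀ hn ω (s, t)).abs_sub_le_of_local
    (fun f₁ f₂ hf => hatEvol_local hC₀ hn ω hst hf) (by positivity) fun z hz => ?_
  obtain ⟨w, hw, hzw⟩ := exists_l1_split hts (by positivity : (0 : ℝ) ≤ 9 / n) hz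
  have e0 := h (y + w) (by rwa [add_sub_cancel_left])
  have e1 := IsLip.abs_sub_le_l1 g₁.2 z (y + w)
  have e2 := IsLip.abs_sub_le_l1 g₂.2 (y + w) z
  rw [← sub_sub] at e1
  rw [show y + w - z = -(z - y - w) by abel, show l1 (-(z - y - w)) = l1 (z - y - w) by
    simp only [l1, Prod.fst_neg, Prod.snd_neg, abs_neg]] at e2
  have e3 : (36 : ℝ) / n = 2 * (9 / n) + 2 * (9 / n) := by ring
  have e4 := abs_sub_le (g₁ z) (g₁ (y + w)) (g₂ z)
  rw [e0] at e4 e1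
  linarith

theorem eq_of_tendsto_of_abs_sub_le {u v : ℕ → ℝ} {a b c : ℝ} {n : ℕ → ℕ}
    (hn : Tendsto n atTop atTop) (hu : Tendsto u atTop (𝓝 a)) (hv : Tendsto v atTop (𝓝 b))
    (h : ∀ j, |u j - v j| ≤ c / n j) : a = b := by
  have h1 : Tendsto (fun j => c / (n j : ℝ)) atTop (𝓝 0) :=
    (tendsto_const_div_atTop_nhds_zero_nat c).comp hn
  have h2 : Tendsto (fun j => |u j - v j|) atTop (𝓝 |a - b|) := (hu.sub hv).abs
  exact sub_eq_zero.1 (abs_nonpos_iff.1 (le_of_tendsto_of_tendsto' h2 h1 h))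

/-- Every limit of discrete evolutions lies in `C⁰_T`, whatever the marks. -/
theorem mem_CTZero_of_tendsto {T C₀ : ℝ} (hC₀ : IsInterpBound C₀) {n : ℕ → ℕ}
    (hn : ∀ j, 0 < n j) (hlim : Tendsto n atTop atTop) (ω : ℕ → Marks) {S : CT T C₀}
    (hS : Tendsto (fun j => hatCT hC₀ (hn j) (ω j)) atTop (𝓝 S)) : S ∈ CTZero T C₀ := by
  have hev : ∀ p, Tendsto (fun j => hatEvol hC₀ (hn j) (ω j) p) atTop (𝓝 (S p)) := fun p =>
    ((continuous_eval_const p).tendsto S).comp hS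
  refine ⟨?_, ?_, ?_, ?_⟩
  · intro s t s' t'
    exact le_of_tendsto' ((hev _).dist (hev _)) fun j =>
      hatCT_mem_CTLip hC₀ (hn j) (ω j) s t s' t'
  · intro g t₁ t₂ h
    refine Subtype.ext (funext fun x => ?_)
    exact eq_of_tendsto_of_abs_sub_le hlim (tendsto_eval_const (hev (t₁, t₂)) g x)
      tendsto_const_nhds fun j => abs_hatS_sub_self_le (hn j) t₂.2.1 h g.2 (ω j) x
  · intro g t₁ t₂ t₃ h12 h23
    refine Subtype.ext (funext fun x => ?_)
    obtain ⟨k, hk⟩ := exists_le_nat_succ (3 * l1 x + |2 * T + 9|)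
    refine eq_of_tendsto_of_abs_sub_le hlim
      (tendsto_eval (hev (t₂, t₃)) (f := fun j => hatEvol hC₀ (hn j) (ω j) (t₁, t₂) g)
        (tendsto_evolSup (hev (t₁, t₂)) k) (fun j => evolSup_nonneg _ _ _)
        fun j y hy => abs_le_evolSup _ _ g (k + 1) y (hy.trans hk))
      (tendsto_eval_const (hev (t₁, t₃)) g x)
      fun j => abs_hatS_hatS_sub_le (hn j) t₁.2.1 h12 h23 g.2 (ω j) x
  · intro x R g₁ g₂ h s t hst y hy
    refine eq_of_tendsto_of_abs_sub_le hlim (tendsto_eval_const (hev (s, t)) g₁ y)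
      (tendsto_eval_const (hev (s, t)) g₂ y)
      fun j => abs_hatEvol_sub_le hC₀ (hn j) (ω j) hst.le fun z hz => h z ?_
    have := l1_add_le (z - y) (y - x)
    rw [sub_add_sub_cancel] at this
    linarith

/-- A weak limit of laws is carried by the set of limits of values of the random elements, by the
portmanteau theorem for closed sets. -/
theorem ae_mem_closure_of_tendsto {T C₀ a : ℝ} (ha : 0 < a) {X : ℕ → Marks → CT T C₀}
    (hX : ∀ n, Measurable (X n)) {ν : ℕ → ℕ} (hν : StrictMono ν)
    {μ : ProbabilityMeasure (CT T C₀)}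
    (h : Tendsto (fun i => evolLaw a ha (X (ν i)) (hX (ν i))) atTop (𝓝 μ)) :
    ∀ᵐ S ∂(μ : Measure (CT T C₀)), ∀ N : ℕ, S ∈ closure {S | ∃ n ≥ N, ∃ ω, X n ω = S} := by
  rw [ae_all_iff]
  intro N
  set A : Set (CT T C₀) := closure {S | ∃ n ≥ N, ∃ ω, X n ω = S} with hA
  have hone : ∀ i ≥ N, (evolLaw a ha (X (ν i)) (hX (ν i)) : Measure (CT T C₀)) A = 1 := by
    intro i hi
    change (marksLaw a ha).map (X (ν i)) A = 1
    rw [Measure.map_apply (hX _) isClosed_closure.measurableSet]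
    have : X (ν i) ⁻¹' A = Set.univ := Set.eq_univ_of_forall fun ω =>
      subset_closure ⟨ν i, hi.trans (hν.le_apply), ω, rfl⟩
    rw [this, measure_univ]
  have hle : (1 : ENNReal) ≤ (μ : Measure (CT T C₀)) A := by
    refine le_trans ?_ (ProbabilityMeasure.limsup_measure_closed_le_of_tendsto h
      (isClosed_closure : IsClosed A))
    rw [limsup_congr (eventually_atTop.2 ⟨N, hone⟩), limsup_const]
  exact (prob_compl_eq_zero_iff isClosed_closure.measurableSet).2 (le_antisymm prob_le_one hle)

end

end DominoShuffling


theorem proposition5p1 (a : ℝ) (ha : 0 < a) (T : ℝ) (hT : 0 < T)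
    (C₀ : ℝ) (hC₀ : IsInterpBound C₀) :
    -- `Shat n` is the random element `Ŝ_n` of `C_T`, for `n ≥ 1`
    ∃ (Shat : ℕ → Marks → CT T C₀) (hmeas : ∀ n, Measurable (Shat n)),
      (∀ n : ℕ, 0 < n → ∀ (ω : Marks) (s t : Set.Icc (0 : ℝ) T) (g : Asymp) (x : ℝ × ℝ),
        Shat n ω (s, t) g x = hatS n s t g ω x) ∧
      ∀ ν : ℕ → ℕ, StrictMono ν → (∀ i, 0 < ν i) →
        ∀ μ : ProbabilityMeasure (CT T C₀),
          Tendsto (fun i => evolLaw a ha (Shat (ν i)) (hmeas (ν i))) atTop (𝓝 μ) →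
          ∀ᵐ S ∂(μ : Measure (CT T C₀)), S ∈ CTZero T C₀ := by
  refine ⟨randomEvol hC₀, measurable_randomEvol hC₀, ?_, ?_⟩
  · intro n hn ω s t g x
    rw [randomEvol_of_pos hC₀ hn]
    rfl
  · intro ν hν _ μ hμ
    filter_upwards [ae_mem_closure_of_tendsto ha (measurable_randomEvol hC₀) hν hμ] with S hS
    have hex : ∀ j : ℕ, ∃ n, j + 1 ≤ n ∧ ∃ ω, dist S (randomEvol hC₀ n ω) < 1 / ((j : ℝ) + 1) := by
      intro j
      obtain ⟨_, ⟨n, hn, ω, rfl⟩, hd⟩ := Metric.mem_closure_iff.1 (hS (j + 1)) (1 / ((j : ℝ) + 1))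
        Nat.one_div_pos_of_nat
      exact ⟨n, hn, ω, hd⟩
    choose n hn ω hd using hex
    have hpos : ∀ j, 0 < n j := fun j => (Nat.succ_pos j).trans_le (hn j)
    refine mem_CTZero_of_tendsto hC₀ hpos
      (tendsto_atTop_mono (fun j => (Nat.le_succ j).trans (hn j)) tendsto_id) ω ?_
    rw [tendsto_iff_dist_tendsto_zero]
    refine squeeze_zero (fun _ => dist_nonneg) (fun j => ?_) tendsto_one_div_add_atTop_nhds_zero_nat
    rw [dist_comm, ← randomEvol_of_pos hC₀ (hpos j)]
    exact (hd j).le
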